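/- Let $\overline\rho>0$, $f\in C^1[0,\overline\rho]$ with $f(0)=0$ and $h:=f'$; let $D,g$ be continuous on $[0,\overline\rho]$. Consider the equation $$\rho_t+f(\rho)_x=(D(\rho)\rho_x)_x+g(\rho).\qquad (E_g)$$ **Conditions.** - $(\hat{\rm D})$: $D\in C^1[0,\overline\rho]$ and $D>0$ in $(0,\overline\rho)$. - $(\tilde{\rm D})$ (on the pair $D,g$): $D\in C[0,\overline\rho]\cap C^1[0,\overline\rho)$, $D(\overline\rho)=0$, $D>0$ in $(0,\overline\rho)$, $\dot D(\overline\rho)=-\infty$, and $\lim_{\rho\to\overline\rho^-}\frac{D(\rho)g(\rho)}{\rho-\overline\rho}$ exists in $(-\infty,0]$. - $({\rm g})$: $g>0$ in $[0,\overline\rho)$ and $g(\overline\rho)=0$. - $({\rm g}_0)$: $g>0$ in $(0,\overline\rho)$, $g(0)=g(\overline\rho)=0$ and $\limsup_{\rho\to0^+}\frac{D(\rho)g(\rho)}{\rho}<+\infty$. **Profiles.** A traveling-wave profile of $(E_g)$ with speed $c\in\mathbb R$ on an open interval $I$ is a continuous, a.e. differentiable $\varphi:I\to[0,\overline\rho]$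 with $D(\varphi)\varphi'\in L^1_{\rm loc}(I)$ and $$\int_I\{(D(\varphi)\varphi'-f(\varphi)+c\varphi)\psi'-g(\varphi)\psi\}\,d\xi=0\quad\text{for all }\psi\in C_0^\infty(I).$$ It is classical in an open set $U\subseteq I$ if in $U$ it is differentiable, $D(\varphi)\varphi'$ is absolutely continuous on compact intervals, and $(D(\varphi)\varphi')'+(c-h(\varphi))\varphi'+g(\varphi)=0$ a.e. All profiles below are assumed to be classical or sharp, that is, classical in $I\setminus S$ for a finite (possibly empty) set $S\subset I$ at each point of which $\varphi$ is not differentiable and takes as value a zero of $g$. - A wavefront profile connecting $\overline\rho$ with $0$ is such a profile on $I=\mathbb R$ with $\varphi(-\infty)=\overline\rho$ and $\varphi(+\infty)=0$, where $g(\overline\rho)=g(0)=0$. - A semi-wavefront profile from $\overline\rho$ is such a profile on $I=(-\infty,\varpi)$, $\varpi\in\mathbb R$, that is (weakly) monotone, non-constant and satisfies $\varphi(\xi)\to\overline\rho$ as $\xi\to-\infty$, where $g(\overline\rho)=0$. It is maximal if it does not extend to a semi-wavefront profile from $\overline\rho$, with the same speed, on a half-line $(-\infty,\varpi')$ with $\varpi'>\varpi$.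 **Theorem (Convergence of semi-wavefront profiles to a wavefront profile).** Let $g_0\in C[0,\overline\rho]$ satisfy $({\rm g}_0)$, and let $\{g_n\}_{n\ge1}\subset C[0,\overline\rho]$ be a decreasing sequence (that is, $g_{n+1}\le g_n$ on $[0,\overline\rho]$) of functions that satisfy $({\rm g})$, with $g_n\to g_0$ uniformly on $[0,\overline\rho]$. Assume that either $D$ satisfies $(\hat{\rm D})$, or $(D,g_n)$ satisfies $(\tilde{\rm D})$ for every $n\ge0$. Let $c_0^*$ be the threshold speed for $g_0$, i.e. the infimum of the speeds of the wavefront profiles of $(E_{g_0})$ connecting $\overline\rho$ with $0$, and let $c\ge c_0^*$. Let $\varphi_0$ be a wavefront profile of $(E_{g_0})$ connecting $\overline\rho$ with $0$ and, for $n\ge1$, let $\varphi_n:(-\infty,\varpi_n)\to[0,\overline\rho]$ be a maximal semi-wavefront profile of $(E_{g_n})$ from $\overline\rho$, all of them with speed $c$, with $\varpi_n>0$ and $\varphi_n(0)=\overline\rho/2$ for every $n$ (including $n=0$ for the last equality). Let $J$ be the maximal open interval on which $0<\varphi_0<\overline\rho$. Then $\varphi_n\to\varphi_0$ in $C^1_{\rm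 loc}(J)$: $\varphi_0\in C^1(J)$ and, for every compact $K\subset J$, for all large $n$ the profile $\varphi_n$ is defined and $C^1$ in a neighborhood of $K$, and $\varphi_n\to\varphi_0$ and $\varphi_n'\to\varphi_0'$ uniformly on $K$. -/

import Mathlib

open Set Filter Topology MeasureTheory
open scoped ContDiff

namespace SemiWave

/-! The equation is `ρ_t + f(ρ)_x = (D(ρ) ρ_x)_x + g(ρ)` with unknown valued in `[0, ρbar]`.
The functions `f`, `D`, `g` are total functions on `ℝ`; only their values on `Icc 0 ρbar` matter.
A profile defined on an open interval `I` is a total function of which only the values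
on `I` matter. -/

/-- `h = f'` on `[0, ρbar]` (one-sided derivatives at the end points). -/
noncomputable def h (ρbar : ℝ) (f : ℝ → ℝ) : ℝ → ℝ := derivWithin f (Icc 0 ρbar)

/-- Condition (D̂): `D ∈ C¹[0, ρbar]` is positive in `(0, ρbar)`. -/
structure CondDhat (ρbar : ℝ) (D : ℝ → ℝ) : Prop where
  contDiffOn : ContDiffOn ℝ 1 D (Icc 0 ρbar)
  pos : ∀ ρ ∈ Ioo 0 ρbar, 0 < D ρ

/-- Condition (D̃), a joint condition on `D` and the source term `g`. -/
structure CondDtilde (ρbar : ℝ) (D g : ℝ → ℝ) : Prop where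
  continuousOn : ContinuousOn D (Icc 0 ρbar)
  contDiffOn : ContDiffOn ℝ 1 D (Ico 0 ρbar)
  eq_zero : D ρbar = 0
  pos : ∀ ρ ∈ Ioo 0 ρbar, 0 < D ρ
  /-- the left derivative of `D` at `ρbar` is `-∞` -/
  deriv_eq : Tendsto (fun ρ => (D ρ - D ρbar) / (ρ - ρbar)) (𝓝[<] ρbar) atBot
  limit : ∃ L : ℝ, L ≤ 0 ∧ Tendsto (fun ρ => D ρ * g ρ / (ρ - ρbar)) (𝓝[<] ρbar) (𝓝 L)

/-- Condition (g), for a continuous source term. -/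
structure CondG (ρbar : ℝ) (g : ℝ → ℝ) : Prop where
  continuousOn : ContinuousOn g (Icc 0 ρbar)
  pos : ∀ ρ ∈ Ico 0 ρbar, 0 < g ρ
  eq_zero : g ρbar = 0

/-- Condition (g₀) (monostability), for a continuous source term. -/
structure CondG₀ (ρbar : ℝ) (D g : ℝ → ℝ) : Prop where
  continuousOn : ContinuousOn g (Icc 0 ρbar)
  pos : ∀ ρ ∈ Ioo 0 ρbar, 0 < g ρ
  eq_zero_left : g 0 = 0
  eq_zero_right : g ρbar = 0
  limsup_lt : limsup (fun ρ => ((D ρ * g ρ / ρ : ℝ) : EReal)) (𝓝[>] 0) < ⊤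

/-- `φ` is the profile of a traveling-wave solution with speed `c`, on the open interval `I`. -/
structure IsTravelingWave (ρbar : ℝ) (f D g : ℝ → ℝ) (c : ℝ) (I : Set ℝ) (φ : ℝ → ℝ) :
    Prop where
  isOpen : IsOpen I
  ordConnected : I.OrdConnected
  mapsTo : MapsTo φ I (Icc 0 ρbar)
  continuousOn : ContinuousOn φ I
  ae_differentiableAt : ∀ᵐ ξ ∂(volume.restrict I), DifferentiableAt ℝ φ ξ
  locallyIntegrableOn : LocallyIntegrableOn (fun ξ => D (φ ξ) * deriv φ ξ) I
  weak : ∀ ψ : ℝ → ℝ, ContDiff ℝ ∞ ψ → HasCompactSupport ψ → tsupport ψ ⊆ I →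
    ∫ ξ in I, ((D (φ ξ) * deriv φ ξ - f (φ ξ) + c * φ ξ) * deriv ψ ξ - g (φ ξ) * ψ ξ) = 0

/-- `φ` is classical in the open set `U`: it is differentiable, `D(φ) φ'` is absolutely continuous
(on compact intervals) and `(D(φ) φ')' + (c - h(φ)) φ' + g(φ) = 0` a.e. -/
structure IsClassicalOn (ρbar : ℝ) (f D g : ℝ → ℝ) (c : ℝ) (U : Set ℝ) (φ : ℝ → ℝ) :
    Prop where
  differentiableAt : ∀ ξ ∈ U, DifferentiableAt ℝ φ ξ
  absolutelyContinuous : ∀ a b : ℝ, a ≤ b → Icc a b ⊆ U →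
    AbsolutelyContinuousOnInterval (fun ξ => D (φ ξ) * deriv φ ξ) a b
  equation : ∀ᵐ ξ ∂(volume.restrict U),
    HasDerivAt (fun ξ => D (φ ξ) * deriv φ ξ)
      (-((c - h ρbar f (φ ξ)) * deriv φ ξ + g (φ ξ))) ξ

/-- `φ` is classical or sharp in `I`: it is classical in `I` except at finitely many points (possibly
none), at each of which it takes a zero of `g` as its value and is not differentiable.
(A profile may be sharp at both zeros of `g`.) -/
def IsClassicalOrSharp (ρbar : ℝ) (f D g : ℝ → ℝ) (c : ℝ) (I : Set ℝ) (φ : ℝ → ℝ) : Prop :=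
  ∃ S : Set ℝ, S.Finite ∧ S ⊆ I ∧ (∀ ξ ∈ S, g (φ ξ) = 0 ∧ ¬ DifferentiableAt ℝ φ ξ) ∧
    IsClassicalOn ρbar f D g c (I \ S) φ

/-- `φ` is a (classical or sharp) profile on `(-∞, ϖ)` of a semi-wavefront solution from `ℓ`. -/
structure IsSemiWavefrontFrom (ρbar : ℝ) (f D g : ℝ → ℝ) (c ℓ ϖ : ℝ) (φ : ℝ → ℝ) : Prop where
  travelingWave : IsTravelingWave ρbar f D g c (Iio ϖ) φ
  classicalOrSharp : IsClassicalOrSharp ρbar f D g c (Iio ϖ) φ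
  mem : ℓ ∈ Icc 0 ρbar
  source_eq_zero : g ℓ = 0
  monotonic : MonotoneOn φ (Iio ϖ) ∨ AntitoneOn φ (Iio ϖ)
  nonconstant : ∃ ξ₁ ∈ Iio ϖ, ∃ ξ₂ ∈ Iio ϖ, φ ξ₁ ≠ φ ξ₂
  tendsto : Tendsto φ atBot (𝓝 ℓ)

/-- A semi-wavefront profile from `ℓ` on `(-∞, ϖ)` that is maximal: it does not extend to
a semi-wavefront profile on a larger half-line. -/
def IsMaximalSemiWavefrontFrom (ρbar : ℝ) (f D g : ℝ → ℝ) (c ℓ ϖ : ℝ) (φ : ℝ → ℝ) : Prop :=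
  IsSemiWavefrontFrom ρbar f D g c ℓ ϖ φ ∧
    ∀ ϖ' : ℝ, ϖ < ϖ' → ¬ ∃ φ' : ℝ → ℝ,
      IsSemiWavefrontFrom ρbar f D g c ℓ ϖ' φ' ∧ EqOn φ' φ (Iio ϖ)

/-- `φ` is a (classical or sharp) wavefront profile connecting `ℓm` (at `-∞`) with `ℓp` (at `+∞`). -/
structure IsWavefront (ρbar : ℝ) (f D g : ℝ → ℝ) (c ℓm ℓp : ℝ) (φ : ℝ → ℝ) : Prop where
  travelingWave : IsTravelingWave ρbar f D g c univ φ
  classicalOrSharp : IsClassicalOrSharp ρbar f D g c univ φ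
  source_left : g ℓm = 0
  source_right : g ℓp = 0
  tendsto_atBot : Tendsto φ atBot (𝓝 ℓm)
  tendsto_atTop : Tendsto φ atTop (𝓝 ℓp)

/-- The threshold speed: the infimum of the speeds of the wavefronts connecting `ρbar` with `0`
(in the extended reals, so that no convention is needed for an empty set of speeds). -/
noncomputable def thresholdSpeed (ρbar : ℝ) (f D g : ℝ → ℝ) : EReal :=
  sInf {s : EReal | ∃ c : ℝ, s = (c : EReal) ∧ ∃ φ : ℝ → ℝ, IsWavefront ρbar f D g c ρbar 0 φ}

/-- `J` is a maximal open interval on which `0 < φ < ρbar`. -/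
def IsMaximalOpenInterval (ρbar : ℝ) (φ : ℝ → ℝ) (J : Set ℝ) : Prop :=
  Maximal (fun K : Set ℝ => IsOpen K ∧ K.OrdConnected ∧ ∀ ξ ∈ K, 0 < φ ξ ∧ φ ξ < ρbar) J

/-- Convergence in `C¹_loc(J)` of functions `φ n`, defined on the sets `I n`, to `φ₀`: the limit
is `C¹` in `J` and, for each compact `K ⊆ J`, the function `φ n` is defined and `C¹` near `K` for all
large `n`, and `φ n → φ₀`, `(φ n)' → φ₀'` uniformly on `K`. -/
def TendstoC1Loc (I : ℕ → Set ℝ) (φ : ℕ → ℝ → ℝ) (φ₀ : ℝ → ℝ) (J : Set ℝ) : Prop :=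
  ContDiffOn ℝ 1 φ₀ J ∧
    ∀ K : Set ℝ, IsCompact K → K ⊆ J →
      (∀ᶠ n in atTop, ∃ U : Set ℝ, IsOpen U ∧ K ⊆ U ∧ U ⊆ I n ∧ ContDiffOn ℝ 1 (φ n) U) ∧
      TendstoUniformlyOn φ φ₀ atTop K ∧
      TendstoUniformlyOn (fun n => deriv (φ n)) (deriv φ₀) atTop K

end SemiWave

/-!
Integrated once, the equation of a profile `φ` reads `D(φ) φ' = v + f(φ) - c φ` with `v' = -g(φ)`.
Hence `φ` is decreasing where `0 < φ < ρbar`, and there it is encoded in the phase plane by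
`Z = D(φ) φ' < 0` as a function of the density, which solves `Z' = h - c - g D / Z` and vanishes at
`ρbar`. The solutions of this singular problem are ordered by `g`, and the gap between two of them
is controlled by the gap between the sources; so `Z n → Z₀` locally uniformly in `(0, ρbar)`. The
inverse profiles solve `y' = D / Z` and agree at the common value of the profiles at `0`, hence they
converge as well, and inverting them gives the convergence of `φ n` and of
`(φ n)' = Z n (φ n) / D (φ n)`.

The inverse profiles all have to be defined in the whole of `(0, ρbar)`. This is where maximality
enters: if a profile stopped at a value `ℓ ∈ (0, ρbar)`, the limit of `D(φ) φ'` there would be some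
`Z < 0`, and solving the equation locally from `(ℓ, Z)` would extend it.
-/

namespace SemiWave

/-! ### Absolute continuity and test functions -/

theorem absolutelyContinuousOnInterval_congr {u w : ℝ → ℝ} {a b : ℝ} (h : EqOn u w (uIcc a b))
    (hu : AbsolutelyContinuousOnInterval u a b) : AbsolutelyContinuousOnInterval w a b := by
  rw [absolutelyContinuousOnInterval_iff] at hu ⊢
  intro ε hε
  obtain ⟨δ, hδ, H⟩ := hu ε hε
  refine ⟨δ, hδ, fun E hE hlt => ?_⟩
  convert H E hE hlt using 1
  refine Finset.sum_congr rfl fun i hi => ?_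
  rw [h (hE.1 i hi).1, h (hE.1 i hi).2]

theorem absolutelyContinuousOnInterval_trans {u : ℝ → ℝ} {a m b : ℝ} (ham : a ≤ m) (hmb : m ≤ b)
    (h₁ : AbsolutelyContinuousOnInterval u a m) (h₂ : AbsolutelyContinuousOnInterval u m b) :
    AbsolutelyContinuousOnInterval u a b := by
  have i₁ := h₁.intervalIntegrable_deriv
  have i₂ := h₂.intervalIntegrable_deriv
  have fundamental : EqOn ((fun _ => u a) + fun x => ∫ t in a..x, deriv u t) u (uIcc a b) := by
    intro x hx
    rw [uIcc_of_le (ham.trans hmb)] at hx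
    rcases le_total x m with hxm | hmx
    · have hax := h₁.mono (uIcc_subset_uIcc_left (mem_uIcc_of_le hx.1 hxm))
      simp only [Pi.add_apply, hax.integral_deriv_eq_sub, add_sub_cancel]
    · have hmx := h₂.mono (uIcc_subset_uIcc_left (mem_uIcc_of_le hmx hx.2))
      simp only [Pi.add_apply, ← intervalIntegral.integral_add_adjacent_intervals i₁
        hmx.intervalIntegrable_deriv, hmx.integral_deriv_eq_sub, h₁.integral_deriv_eq_sub]
      ring
  exact absolutelyContinuousOnInterval_congr fundamental
    (contDiffOn_const.absolutelyContinuousOnInterval.add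
      ((i₁.trans i₂).absolutelyContinuousOnInterval_intervalIntegral left_mem_uIcc))

theorem continuousOn_of_absolutelyContinuousOnInterval {U : Set ℝ} (hU : IsOpen U) {u : ℝ → ℝ}
    (hu : ∀ a b : ℝ, a ≤ b → Icc a b ⊆ U → AbsolutelyContinuousOnInterval u a b) :
    ContinuousOn u U := by
  intro x hx
  obtain ⟨ε, hε, hball⟩ := Metric.nhds_basis_closedBall.mem_iff.1 (hU.mem_nhds hx)
  rw [Real.closedBall_eq_Icc] at hball
  have hle : x - ε ≤ x + ε := by linarith
  have hcont := (hu _ _ hle hball).continuousOn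
  rw [uIcc_of_le hle] at hcont
  exact (hcont.continuousAt (Icc_mem_nhds (by linarith) (by linarith))).continuousWithinAt

theorem absolutelyContinuousOnInterval_of_subset_union {u : ℝ → ℝ} {U V : Set ℝ} (hU : IsOpen U)
    (hV : IsOpen V)
    (hu : ∀ a b : ℝ, a ≤ b → Icc a b ⊆ U → AbsolutelyContinuousOnInterval u a b)
    (hv : ∀ a b : ℝ, a ≤ b → Icc a b ⊆ V → AbsolutelyContinuousOnInterval u a b)
    {a b : ℝ} (hab : a ≤ b) (hsub : Icc a b ⊆ U ∪ V) : AbsolutelyContinuousOnInterval u a b := by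
  obtain ⟨t, ht0, htm, ⟨m, hm⟩, hcover⟩ := exists_monotone_Icc_subset_open_cover_Icc hab
    (c := fun W : ({U, V} : Set (Set ℝ)) => Subtype.val ⁻¹' W.1)
    (by rintro ⟨W, rfl | rfl⟩ <;> exact IsOpen.preimage continuous_subtype_val ‹_›)
    (fun x _ => by simpa using hsub x.2)
  have hpiece : ∀ n, AbsolutelyContinuousOnInterval u (t n) (t (n + 1)) := fun n => by
    have hle : (t n : ℝ) ≤ t (n + 1) := htm n.le_succ
    obtain ⟨⟨W, hW⟩, hsubW⟩ := hcover n
    have hsub' : Icc (t n : ℝ) (t (n + 1)) ⊆ W := fun x hx =>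
      hsubW (a := ⟨x, (t n).2.1.trans hx.1, hx.2.trans (t (n + 1)).2.2⟩) hx
    rcases hW with rfl | rfl
    exacts [hu _ _ hle hsub', hv _ _ hle hsub']
  have hprefix : ∀ n, AbsolutelyContinuousOnInterval u a (t n) := fun n => by
    induction n with
    | zero =>
      rw [ht0]
      exact LipschitzOnWith.absolutelyContinuousOnInterval (K := 0) (by simp [LipschitzOnWith])
    | succ n ih =>
      exact absolutelyContinuousOnInterval_trans (t n).2.1 (htm n.le_succ) ih (hpiece n)
  simpa only [hm m le_rfl] using hprefix m

theorem integrableOn_mul_of_tsupport_subset {I : Set ℝ} (hI : MeasurableSet I) {w χ : ℝ → ℝ}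
    (hw : LocallyIntegrableOn w I) (hχ : Continuous χ) (χc : HasCompactSupport χ)
    (χI : tsupport χ ⊆ I) : IntegrableOn (fun x => w x * χ x) I := by
  refine IntegrableOn.of_forall_sdiff_eq_zero
    ((hw.integrableOn_compact_subset χI χc).mul_continuousOn hχ.continuousOn χc) hI fun x hx => ?_
  rw [image_eq_zero_of_notMem_tsupport hx.2, mul_zero]

theorem exists_contDiff_integral_eq_one {I : Set ℝ} (hI : IsOpen I) (hne : I.Nonempty) :
    ∃ η : ℝ → ℝ, ContDiff ℝ ∞ η ∧ HasCompactSupport η ∧ tsupport η ⊆ I ∧ ∫ x, η x = 1 := by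
  obtain ⟨p, hp⟩ := hne
  obtain ⟨r, hr, hball⟩ := Metric.isOpen_iff.1 hI p hp
  let b : ContDiffBump p := ⟨r / 4, r / 2, by positivity, by linarith⟩
  refine ⟨b.normed volume, b.contDiff_normed, b.hasCompactSupport_normed, ?_, b.integral_normed⟩
  rw [b.tsupport_normed_eq]
  exact (Metric.closedBall_subset_ball (half_lt_self hr)).trans hball

theorem exists_contDiff_deriv_eq_of_integral_eq_zero {I : Set ℝ} (hI : I.OrdConnected)
    {θ : ℝ → ℝ} (θs : ContDiff ℝ ∞ θ) (θc : HasCompactSupport θ) (θI : tsupport θ ⊆ I)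
    (θint : ∫ x, θ x = 0) :
    ∃ ψ : ℝ → ℝ, ContDiff ℝ ∞ ψ ∧ HasCompactSupport ψ ∧ tsupport ψ ⊆ I ∧ deriv ψ = θ := by
  rcases (tsupport θ).eq_empty_or_nonempty with hempty | hne
  · rw [tsupport_eq_empty_iff] at hempty
    exact ⟨0, contDiff_const, HasCompactSupport.zero, by simp [tsupport], by simp [hempty]⟩
  set A := sInf (tsupport θ)
  set B := sSup (tsupport θ)
  have hsub : tsupport θ ⊆ Icc A B := subset_Icc_csInf_csSup θc.isCompact.bddBelow
    θc.isCompact.bddAbove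
  have hsupp : Function.support θ ⊆ Ioo A B := interior_Icc (a := A) (b := B) ▸
    interior_maximal ((subset_tsupport θ).trans hsub) θs.continuous.isOpen_support
  have hderiv : ∀ x, HasDerivAt (fun x => ∫ t in A..x, θ t) (θ x) x := fun x =>
    θs.continuous.integral_hasStrictDerivAt A x |>.hasDerivAt
  have hderiv' : deriv (fun x => ∫ t in A..x, θ t) = θ := funext fun x => (hderiv x).deriv
  have hψ : tsupport (fun x => ∫ t in A..x, θ t) ⊆ Icc A B := by
    refine closure_minimal (fun x hx => by_contra fun h => hx ?_) isClosed_Icc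
    rcases lt_or_ge x A with hxA | hAx
    · refine (intervalIntegral.integral_congr fun t ht => ?_).trans
        intervalIntegral.integral_zero
      rw [uIcc_of_ge hxA.le] at ht
      exact Function.notMem_support.1 fun h => (hsupp h).1.not_ge ht.2
    · have hBx : B < x := not_le.1 fun hxB => h ⟨hAx, hxB⟩
      exact (intervalIntegral.integral_eq_integral_of_support_subset
        (hsupp.trans fun t ht => ⟨ht.1, ht.2.le.trans hBx.le⟩)).trans θint
  refine ⟨_, contDiff_infty_iff_deriv.2 ⟨fun x => (hderiv x).differentiableAt, hderiv'.symm ▸ θs⟩,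
    .of_support_subset_isCompact isCompact_Icc (subset_closure.trans hψ),
    hψ.trans (hI.out (θI (θc.isCompact.sInf_mem hne)) (θI (θc.isCompact.sSup_mem hne))), hderiv'⟩

theorem exists_integral_mul_eq_const_mul_integral {I : Set ℝ} (hI : IsOpen I)
    (hc : I.OrdConnected) (hne : I.Nonempty) {w : ℝ → ℝ} (hw : LocallyIntegrableOn w I)
    (h : ∀ ψ : ℝ → ℝ, ContDiff ℝ ∞ ψ → HasCompactSupport ψ → tsupport ψ ⊆ I →
      ∫ x in I, w x * deriv ψ x = 0) :
    ∃ k : ℝ, ∀ χ : ℝ → ℝ, ContDiff ℝ ∞ χ → HasCompactSupport χ → tsupport χ ⊆ I →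
      ∫ x in I, w x * χ x = k * ∫ x, χ x := by
  obtain ⟨η, ηs, ηc, ηI, η1⟩ := exists_contDiff_integral_eq_one hI hne
  refine ⟨∫ x in I, w x * η x, fun χ χs χc χI => ?_⟩
  have iχ : Integrable χ := χs.continuous.integrable_of_hasCompactSupport χc
  have iη : Integrable η := ηs.continuous.integrable_of_hasCompactSupport ηc
  have iwχ := integrableOn_mul_of_tsupport_subset hI.measurableSet hw χs.continuous χc χI
  have iwη := integrableOn_mul_of_tsupport_subset hI.measurableSet hw ηs.continuous ηc ηI
  generalize hm : ∫ x, χ x = m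
  have θs : ContDiff ℝ ∞ (χ - m • η) := χs.sub (ηs.const_smul m)
  have θI : tsupport (χ - m • η) ⊆ I := (tsupport_sub χ _).trans
    (union_subset χI ((tsupport_smul_subset_right (fun _ => m) η).trans ηI))
  have θc : HasCompactSupport (χ - m • η) := χc.sub (ηc.smul_left (f := fun _ => m))
  have θ0 : ∫ x, (χ - m • η) x = 0 := by
    simp [integral_sub iχ (iη.const_mul m), integral_const_mul, η1, hm]
  obtain ⟨ψ, ψs, ψc, ψI, hψ⟩ := exists_contDiff_deriv_eq_of_integral_eq_zero hc θs θc θI θ0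
  have hzero := h ψ ψs ψc ψI
  simp only [hψ, Pi.sub_apply, Pi.smul_apply, smul_eq_mul, mul_sub, mul_left_comm _ m] at hzero
  rw [integral_sub iwχ (iwη.const_mul m), integral_const_mul] at hzero
  linarith

theorem ae_const_of_integral_mul_deriv_eq_zero {I : Set ℝ} (hI : IsOpen I) (hc : I.OrdConnected)
    (hne : I.Nonempty) {w : ℝ → ℝ} (hw : LocallyIntegrableOn w I)
    (h : ∀ ψ : ℝ → ℝ, ContDiff ℝ ∞ ψ → HasCompactSupport ψ → tsupport ψ ⊆ I →
      ∫ x in I, w x * deriv ψ x = 0) :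
    ∃ k : ℝ, ∀ᵐ x ∂(volume.restrict I), w x = k := by
  obtain ⟨k, hk⟩ := exists_integral_mul_eq_const_mul_integral hI hc hne hw h
  refine ⟨k, ?_⟩
  have kloc : LocallyIntegrableOn (fun _ => k) I :=
    (locallyIntegrable_const k).locallyIntegrableOn I
  have hzero := hI.ae_eq_zero_of_integral_contDiff_smul_eq_zero (hw.sub kloc)
    fun χ χs χc χI => by
      have iχ : Integrable χ := χs.continuous.integrable_of_hasCompactSupport χc
      have hvanish : ∀ x ∉ I, χ x = 0 := fun x hx =>
        image_eq_zero_of_notMem_tsupport fun h' => hx (χI h')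
      calc ∫ x, χ x • (w x - k) = ∫ x in I, (w x * χ x - k * χ x) := by
            rw [← setIntegral_eq_integral_of_forall_compl_eq_zero (s := I)
              fun x hx => by rw [hvanish x hx, zero_smul]]
            simp only [smul_eq_mul, mul_comm (χ _), sub_mul]
        _ = (∫ x in I, w x * χ x) - k * ∫ x in I, χ x := by
            rw [integral_sub (integrableOn_mul_of_tsupport_subset hI.measurableSet hw
              χs.continuous χc χI) (iχ.integrableOn.const_mul k), integral_const_mul]
        _ = 0 := by
            rw [setIntegral_eq_integral_of_forall_compl_eq_zero hvanish, hk χ χs χc χI, sub_self]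
  rw [ae_restrict_iff' hI.measurableSet]
  filter_upwards [hzero] with x hx hxI using sub_eq_zero.1 (hx hxI)

theorem integral_mul_deriv_eq_neg_integral_mul {I : Set ℝ} (hI : MeasurableSet I) {G q ψ : ℝ → ℝ}
    (hG : ∀ x ∈ I, HasDerivAt G (q x) x) (hq : LocallyIntegrableOn q I)
    (ψs : ContDiff ℝ ∞ ψ) (ψc : HasCompactSupport ψ) (ψI : tsupport ψ ⊆ I) :
    ∫ x in I, G x * deriv ψ x = -∫ x in I, q x * ψ x := by
  have Gloc : LocallyIntegrableOn G I := ContinuousOn.locallyIntegrableOn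
    (fun x hx => (hG x hx).continuousAt.continuousWithinAt) hI
  have whole {p χ : ℝ → ℝ} (hp : LocallyIntegrableOn p I) (hχ : Continuous χ)
      (hsupp : tsupport χ ⊆ tsupport ψ) : Integrable (fun x => p x * χ x) ∧
        ∫ x in I, p x * χ x = ∫ x, p x * χ x := by
    have hzero : ∀ x ∉ I, p x * χ x = 0 := fun x hx => by
      rw [image_eq_zero_of_notMem_tsupport fun h' => hx (ψI (hsupp h')), mul_zero]
    refine ⟨(integrableOn_mul_of_tsupport_subset hI hp hχ (ψc.mono' ?_)
      (hsupp.trans ψI)).integrable_of_forall_notMem_eq_zero hzero,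
      setIntegral_eq_integral_of_forall_compl_eq_zero hzero⟩
    exact (subset_tsupport χ).trans hsupp
  obtain ⟨i₁, e₁⟩ := whole Gloc (ψs.continuous_deriv (by simp)) tsupport_deriv_subset
  obtain ⟨i₂, e₂⟩ := whole hq ψs.continuous subset_rfl
  obtain ⟨i₃, -⟩ := whole Gloc ψs.continuous subset_rfl
  rw [e₁, e₂, eq_neg_iff_add_eq_zero, ← integral_add i₁ i₂]
  refine integral_eq_zero_of_hasDerivAt_of_integrable (f := fun x => G x * ψ x) (fun x => ?_)
    (i₁.add i₂) i₃
  by_cases hx : x ∈ tsupport ψ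
  · exact ((hG x (ψI hx)).fun_mul (ψs.differentiable (by simp) x).hasDerivAt).congr_deriv
      (add_comm _ _)
  · have hψ : ψ =ᶠ[𝓝 x] 0 := notMem_tsupport_iff_eventuallyEq.1 hx
    rw [hψ.deriv_eq, hψ.self_of_nhds]
    refine ((hasDerivAt_const x (0 : ℝ)).congr_of_eventuallyEq ?_).congr_deriv (by simp)
    filter_upwards [hψ] with t ht
    simp [ht]

theorem exists_antiderivative_of_weak {I : Set ℝ} (hI : IsOpen I) (hc : I.OrdConnected)
    (hne : I.Nonempty) {w q : ℝ → ℝ} (hw : LocallyIntegrableOn w I) (hq : ContinuousOn q I)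
    (h : ∀ ψ : ℝ → ℝ, ContDiff ℝ ∞ ψ → HasCompactSupport ψ → tsupport ψ ⊆ I →
      ∫ x in I, (w x * deriv ψ x - q x * ψ x) = 0) :
    ∃ v : ℝ → ℝ, (∀ x ∈ I, HasDerivAt v (-q x) x) ∧ ∀ᵐ x ∂(volume.restrict I), w x = v x := by
  have hm := hI.measurableSet
  obtain ⟨p, hp⟩ := hne
  set G : ℝ → ℝ := fun x => ∫ t in p..x, q t
  have hG : ∀ x ∈ I, HasDerivAt G (q x) x := fun x hx =>
    intervalIntegral.integral_hasDerivAt_right ((hq.mono (hc.uIcc_subset hp hx)).intervalIntegrable)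
      (hq.stronglyMeasurableAtFilter hI x hx) (hq.continuousAt (hI.mem_nhds hx))
  have Gloc : LocallyIntegrableOn G I := ContinuousOn.locallyIntegrableOn
    (fun x hx => (hG x hx).continuousAt.continuousWithinAt) hm
  have qloc : LocallyIntegrableOn q I := hq.locallyIntegrableOn hm
  obtain ⟨k, hk⟩ := ae_const_of_integral_mul_deriv_eq_zero hI hc ⟨p, hp⟩ (hw.add Gloc)
    fun ψ ψs ψc ψI => by
      have dc : Continuous (deriv ψ) := ψs.continuous_deriv (by simp)
      have dI := tsupport_deriv_subset.trans ψI
      have iw := integrableOn_mul_of_tsupport_subset hm hw dc ψc.deriv dI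
      have hweak := h ψ ψs ψc ψI
      rw [integral_sub iw (integrableOn_mul_of_tsupport_subset hm qloc ψs.continuous ψc ψI)]
        at hweak
      simp only [Pi.add_apply, add_mul]
      rw [integral_add iw (integrableOn_mul_of_tsupport_subset hm Gloc dc ψc.deriv dI),
        integral_mul_deriv_eq_neg_integral_mul hm hG qloc ψs ψc ψI, ← sub_eq_add_neg, hweak]
  refine ⟨fun x => k - G x, fun x hx => (hG x hx).const_sub k, ?_⟩
  filter_upwards [hk] with x hx using eq_sub_of_add_eq hx

/-! ### Calculus of one real variable -/

theorem nonpos_of_isLocalMaxOn_Ioi {u : ℝ → ℝ} {d x : ℝ} (hu : HasDerivAt u d x)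
    (hmax : IsLocalMaxOn u (Ioi x) x) : d ≤ 0 := by
  have hslope : Tendsto (slope u x) (𝓝[>] x) (𝓝 d) :=
    (hasDerivAt_iff_tendsto_slope.1 hu).mono_left (nhdsWithin_mono x fun t ht => ne_of_gt ht)
  refine le_of_tendsto hslope ?_
  filter_upwards [hmax, self_mem_nhdsWithin] with t ht hxt
  rw [slope_def_field]
  exact div_nonpos_of_nonpos_of_nonneg (sub_nonpos.2 ht) (sub_nonneg.2 (le_of_lt hxt))

theorem nonneg_of_isLocalMaxOn_Iio {u : ℝ → ℝ} {d x : ℝ} (hu : HasDerivAt u d x)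
    (hmax : IsLocalMaxOn u (Iio x) x) : 0 ≤ d := by
  have hslope : Tendsto (slope u x) (𝓝[<] x) (𝓝 d) :=
    (hasDerivAt_iff_tendsto_slope.1 hu).mono_left (nhdsWithin_mono x fun t ht => ne_of_lt ht)
  refine ge_of_tendsto hslope ?_
  filter_upwards [hmax, self_mem_nhdsWithin] with t ht htx
  rw [slope_def_field]
  exact div_nonneg_of_nonpos (sub_nonpos.2 ht) (sub_nonpos.2 (le_of_lt htx))

theorem exists_last_crossing {u : ℝ → ℝ} {a b ρ : ℝ} (hab : a ≤ b)
    (hu : ContinuousOn u (Icc a b)) (ha : ρ ≤ u a) (hb : u b < ρ) :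
    ∃ y ∈ Ico a b, u y = ρ ∧ ∀ t ∈ Ioc y b, u t < ρ := by
  have hcompact : IsCompact (Icc a b ∩ u ⁻¹' Ici ρ) := isCompact_Icc.of_isClosed_subset
    (hu.preimage_isClosed_of_isClosed isClosed_Icc isClosed_Ici) inter_subset_left
  obtain ⟨y, ⟨hy, hρy⟩, hlast⟩ := hcompact.exists_isGreatest ⟨a, left_mem_Icc.2 hab, ha⟩
  have hyb : y < b := hy.2.lt_of_ne fun h => hb.not_ge (h ▸ hρy)
  have hlt : ∀ t ∈ Ioc y b, u t < ρ := fun t ht => by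
    by_contra! h
    exact ht.1.not_ge (hlast ⟨⟨hy.1.trans ht.1.le, ht.2⟩, h⟩)
  obtain ⟨t, ht, hut⟩ := intermediate_value_Icc' hyb.le (hu.mono (Icc_subset_Icc_left hy.1))
    ⟨hb.le, hρy⟩
  have hty : t = y := ht.1.eq_of_not_lt' fun h => (hlt t ⟨h, ht.2⟩).ne hut
  exact ⟨y, ⟨hy.1, hyb⟩, hty ▸ hut, hlt⟩

theorem exists_first_crossing {u : ℝ → ℝ} {a b ρ : ℝ} (hab : a ≤ b)
    (hu : ContinuousOn u (Icc a b)) (ha : u a < ρ) (hb : ρ ≤ u b) :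
    ∃ x ∈ Ioc a b, u x = ρ ∧ ∀ t ∈ Ico a x, u t < ρ := by
  obtain ⟨y, hy, huy, hlt⟩ := exists_last_crossing (u := fun t => u (-t)) (neg_le_neg hab)
    (hu.comp continuousOn_neg fun t ht => ⟨by linarith [ht.2], by linarith [ht.1]⟩)
    (by simpa using hb) (by simpa using ha)
  refine ⟨-y, ⟨by linarith [hy.2], by linarith [hy.1]⟩, huy, fun t ht => ?_⟩
  simpa using hlt (-t) ⟨by linarith [ht.2], by linarith [ht.1]⟩

theorem exists_leftInverse_hasDerivAt {s : Set ℝ} (hs : IsOpen s) {u u' : ℝ → ℝ}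
    (hu : ∀ x ∈ s, HasDerivAt u (u' x) x) (hne : ∀ x ∈ s, u' x ≠ 0)
    (hcont : ContinuousOn u' s) (hinj : InjOn u s) :
    ∃ w : ℝ → ℝ, ∀ x ∈ s, w (u x) = x ∧ HasDerivAt w (u' x)⁻¹ (u x) := by
  have hleft : LeftInvOn (Function.invFunOn u s) u s := hinj.leftInvOn_invFunOn
  refine ⟨Function.invFunOn u s, fun x hx => ⟨hleft hx, ?_⟩⟩
  have hstrict : HasStrictDerivAt u (u' x) x := by
    refine hasStrictDerivAt_of_hasDerivAt_of_continuousAt ?_ (hcont.continuousAt (hs.mem_nhds hx))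
    filter_upwards [hs.mem_nhds hx] with t ht using hu t ht
  refine (hstrict.to_local_left_inverse (hne x hx) ?_).hasDerivAt
  filter_upwards [hs.mem_nhds hx] with t ht using hleft ht

theorem exists_seq_tendsto_deriv_zero_of_tendsto_atBot {u : ℝ → ℝ} {p ℓ : ℝ}
    (hu : ∀ x ≤ p, DifferentiableAt ℝ u x) (hlim : Tendsto u atBot (𝓝 ℓ)) :
    ∃ x : ℕ → ℝ, (∀ n, x n ≤ p) ∧ Tendsto x atTop atBot ∧
      Tendsto (fun n => deriv u (x n)) atTop (𝓝 0) := by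
  have hmvt : ∀ n : ℕ, ∃ x ∈ Ioo (p - n - 1) (p - n), deriv u x = u (p - n) - u (p - n - 1) := by
    intro n
    have hle : ∀ t ≤ p - n, t ≤ p := fun t ht => ht.trans (by simp)
    obtain ⟨x, hx, he⟩ := exists_deriv_eq_slope u (show p - n - 1 < p - n by linarith)
      (fun t ht => (hu t (hle t ht.2)).continuousAt.continuousWithinAt)
      (fun t ht => (hu t (hle t ht.2.le)).differentiableWithinAt)
    exact ⟨x, hx, by rw [he]; simp⟩
  choose x hx hderiv using hmvt
  have hbot : Tendsto (fun n : ℕ => p - (n : ℝ)) atTop atBot :=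
    tendsto_atBot_add_const_left _ p (tendsto_neg_atTop_atBot.comp tendsto_natCast_atTop_atTop)
  refine ⟨x, fun n => (hx n).2.le.trans (by simp), tendsto_atBot_mono (fun n => (hx n).2.le) hbot,
    ?_⟩
  have hdiff := (hlim.comp hbot).sub (hlim.comp (tendsto_atBot_add_const_right _ (-1) hbot))
  rw [sub_self] at hdiff
  exact hdiff.congr fun n => by rw [hderiv n]; rfl

theorem hasDerivAt_ite_of_tendsto {u u' w : ℝ → ℝ} {a d : ℝ}
    (hu : ∀ᶠ t in 𝓝[<] a, HasDerivAt u (u' t) t) (hlim : Tendsto u (𝓝[<] a) (𝓝 (w a)))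
    (hlim' : Tendsto u' (𝓝[<] a) (𝓝 d)) (hw : HasDerivAt w d a) :
    HasDerivAt (fun t => if t < a then u t else w t) d a := by
  set q : ℝ → ℝ := fun t => if t < a then u t else w t
  have hqu : ∀ t < a, q t = u t := fun t ht => if_pos ht
  have hqw : ∀ t, a ≤ t → q t = w t := fun t ht => if_neg ht.not_gt
  have hq : ∀ᶠ t in 𝓝[<] a, HasDerivAt q (u' t) t := by
    filter_upwards [hu, self_mem_nhdsWithin] with t ht hta
    exact ht.congr_of_eventuallyEq (eventually_of_mem (Iio_mem_nhds hta) hqu)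
  have hleft : HasDerivWithinAt q d (Iic a) a := by
    obtain ⟨b, hb, hsub⟩ := mem_nhdsLT_iff_exists_Ioo_subset.1 hq
    refine hasDerivWithinAt_Iic_of_tendsto_deriv
      (fun t ht => (hsub ht).differentiableAt.differentiableWithinAt) ?_ (Ioo_mem_nhdsLT hb) ?_
    · rw [ContinuousWithinAt, hqw a le_rfl]
      refine (hlim.congr' ?_).mono_left (nhdsWithin_mono a Ioo_subset_Iio_self)
      filter_upwards [self_mem_nhdsWithin] with t ht using (hqu t ht).symm
    · exact hlim'.congr' (hq.mono fun t ht => ht.deriv.symm)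
  have hright : HasDerivWithinAt q d (Ici a) a :=
    hw.hasDerivWithinAt.congr hqw (hqw a le_rfl)
  simpa [Iic_union_Ici] using hleft.union hright

theorem exists_tendsto_nhdsLT_of_hasDerivAt_bounded {u u' : ℝ → ℝ} {a M : ℝ}
    (hu : ∀ t < a, HasDerivAt u (u' t) t) (hM : ∀ t < a, |u' t| ≤ M) :
    ∃ ℓ, Tendsto u (𝓝[<] a) (𝓝 ℓ) := by
  have hlip : LipschitzOnWith M.toNNReal u (Iio a) :=
    (convex_Iio a).lipschitzOnWith_of_nnnorm_hasDerivWithin_le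
      (fun t ht => (hu t ht).hasDerivWithinAt) fun t ht =>
        NNReal.le_toNNReal_of_coe_le (by simpa using hM t ht)
  obtain ⟨w, hw, heq⟩ := hlip.extend_real
  refine ⟨w a, (hw.continuous.continuousAt.tendsto.mono_left nhdsWithin_le_nhds).congr' ?_⟩
  filter_upwards [self_mem_nhdsWithin] with t ht using (heq ht).symm

theorem neg_of_tendsto_deriv_neg {u u' : ℝ → ℝ} {a ℓ d : ℝ}
    (hu : ∀ᶠ t in 𝓝[<] a, HasDerivAt u (u' t) t) (hneg : ∀ᶠ t in 𝓝[<] a, u t ≤ 0)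
    (hlim : Tendsto u (𝓝[<] a) (𝓝 ℓ)) (hlim' : Tendsto u' (𝓝[<] a) (𝓝 d)) (hd : d < 0) :
    ℓ < 0 := by
  obtain ⟨s, hs, hsub⟩ := mem_nhdsLT_iff_exists_Ioo_subset.1
    (hu.and (hneg.and (hlim'.eventually_lt_const hd)))
  have hanti : StrictAntiOn u (Ioo s a) := strictAntiOn_of_deriv_neg (convex_Ioo s a)
    (fun t ht => (hsub ht).1.continuousAt.continuousWithinAt) fun t ht => by
      have := hsub (interior_subset ht)
      rw [this.1.deriv]
      exact this.2.2
  obtain ⟨t₁, hst₁, ht₁⟩ := exists_between (mem_Iio.1 hs)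
  obtain ⟨t₂, ht₁₂, ht₂⟩ := exists_between ht₁
  have h₁ := (hsub ⟨hst₁, ht₁⟩).2.1
  refine lt_of_le_of_lt (le_of_tendsto hlim ?_)
    ((hanti ⟨hst₁, ht₁⟩ ⟨hst₁.trans ht₁₂, ht₂⟩ ht₁₂).trans_le h₁)
  filter_upwards [Ioo_mem_nhdsLT ht₂] with t ht
  exact (hanti ⟨hst₁.trans ht₁₂, ht₂⟩ ⟨(hst₁.trans ht₁₂).trans ht.1, ht.2⟩ ht.1).le

theorem nonpos_of_tendsto_zero_of_deriv_pos {u u' : ℝ → ℝ} {a b t : ℝ}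
    (hu : ∀ x ∈ Ioo a b, HasDerivAt u (u' x) x) (hpos : ∀ x ∈ Ioo a b, 0 < u x → 0 < u' x)
    (hlim : Tendsto u (𝓝[<] b) (𝓝 0)) (ht : t ∈ Ioo a b) : u t ≤ 0 := by
  by_contra! hut
  obtain ⟨s, hs, hts, hsb⟩ := ((hlim.eventually_lt_const hut).and (Ioo_mem_nhdsLT ht.2)).exists
  have hsub : Icc t s ⊆ Ioo a b := Icc_subset_Ioo ht.1 hsb
  have hle : ∀ x ∈ Icc t s, u t ≤ u x :=
    image_le_of_deriv_right_lt_deriv_boundary' (f' := fun _ => 0) continuousOn_const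
      (fun x _ => hasDerivWithinAt_const x _ _) le_rfl
      (fun x hx => (hu x (hsub hx)).continuousAt.continuousWithinAt)
      (fun x hx => (hu x (hsub (Ico_subset_Icc_self hx))).hasDerivWithinAt)
      fun x hx hux => hpos x (hsub (Ico_subset_Icc_self hx)) (hux ▸ hut)
  exact hs.not_ge (hle s (right_mem_Icc.2 hts.le))

/-! ### Uniform convergence -/

theorem tendstoLocallyUniformlyOn_const {ι α β : Type*} [TopologicalSpace α] [UniformSpace β]
    {l : Filter ι} {s : Set α} (u : α → β) : TendstoLocallyUniformlyOn (fun _ : ι => u) u l s :=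
  TendstoUniformlyOn.tendstoLocallyUniformlyOn fun _ hV =>
    Eventually.of_forall fun _ _ _ => refl_mem_uniformity hV

theorem tendstoUniformlyOn_of_tendstoUniformlyOn_deriv {ι 𝕜 E : Type*} [RCLike 𝕜]
    [NormedAddCommGroup E] [NormedSpace 𝕜 E] {l : Filter ι} {F F' : ι → 𝕜 → E} {u u' : 𝕜 → E}
    {s : Set 𝕜} {p : 𝕜} (hs : Convex ℝ s) (hb : Bornology.IsBounded s) (hp : p ∈ s)
    (hF : ∀ i, ∀ x ∈ s, HasDerivWithinAt (F i) (F' i x) s x)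
    (hu : ∀ x ∈ s, HasDerivWithinAt u (u' x) s x) (hFu : ∀ i, F i p = u p)
    (hlim : TendstoUniformlyOn F' u' l s) : TendstoUniformlyOn F u l s := by
  obtain ⟨R, hR⟩ := hb.subset_closedBall p
  rw [Metric.tendstoUniformlyOn_iff] at hlim ⊢
  intro ε hε
  obtain ⟨δ, hδ, hδε⟩ := exists_pos_mul_lt hε R
  filter_upwards [hlim δ hδ] with i hi x hx
  have hbound := hs.norm_image_sub_le_of_norm_hasDerivWithin_le
    (fun z hz => (hu z hz).sub (hF i z hz))
    (fun z hz => dist_eq_norm (u' z) (F' i z) ▸ (hi z hz).le)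
    hp hx
  calc dist (u x) (F i x) = ‖(u - F i) x - (u - F i) p‖ := by
        simp only [Pi.sub_apply, hFu i, sub_self, sub_zero, dist_eq_norm]
    _ ≤ δ * ‖x - p‖ := hbound
    _ ≤ δ * R := by gcongr; exact mem_closedBall_iff_norm.1 (hR hx)
    _ < ε := mul_comm R δ ▸ hδε

theorem tendstoLocallyUniformlyOn_of_tendstoLocallyUniformlyOn_deriv {ι E : Type*}
    [NormedAddCommGroup E] [NormedSpace ℝ E] {l : Filter ι} {F F' : ι → ℝ → E} {u u' : ℝ → E}
    {s : Set ℝ} {p : ℝ} (hso : IsOpen s) (hs : s.OrdConnected) (hp : p ∈ s)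
    (hF : ∀ i, ∀ x ∈ s, HasDerivAt (F i) (F' i x) x) (hu : ∀ x ∈ s, HasDerivAt u (u' x) x)
    (hFu : ∀ i, F i p = u p) (hlim : TendstoLocallyUniformlyOn F' u' l s) :
    TendstoLocallyUniformlyOn F u l s := by
  rw [tendstoLocallyUniformlyOn_iff_forall_isCompact hso] at hlim ⊢
  intro K hKs hK
  have hKp := hK.insert p
  have hne := insert_nonempty p K
  have hps : insert p K ⊆ s := insert_subset hp hKs
  have hIcc : insert p K ⊆ Icc (sInf (insert p K)) (sSup (insert p K)) :=
    subset_Icc_csInf_csSup hKp.bddBelow hKp.bddAbove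
  have hsub : Icc (sInf (insert p K)) (sSup (insert p K)) ⊆ s :=
    hs.out (hps (hKp.sInf_mem hne)) (hps (hKp.sSup_mem hne))
  exact (tendstoUniformlyOn_of_tendstoUniformlyOn_deriv (convex_Icc _ _)
    (Metric.isBounded_Icc _ _) (hIcc (mem_insert p K))
    (fun i x hx => (hF i x (hsub hx)).hasDerivWithinAt)
    (fun x hx => (hu x (hsub hx)).hasDerivWithinAt) hFu (hlim _ hsub isCompact_Icc)).mono
    ((subset_insert p K).trans hIcc)

theorem tendstoUniformlyOn_of_inverse {ι α β : Type*} [UniformSpace α] [UniformSpace β]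
    {l : Filter ι} {u : α → β} {w : β → α} {F : ι → α → β} {G : ι → β → α} {K : Set α} {L : Set β}
    (hK : IsCompact K) (hu : ∀ x ∈ K, ContinuousAt u x) (hw : RightInvOn w u L)
    (hF : ∀ᶠ i in l, MapsTo (F i) K L ∧ LeftInvOn (G i) (F i) K)
    (hG : TendstoUniformlyOn G w l L) : TendstoUniformlyOn F u l K := by
  intro V hV
  filter_upwards [hF, hG _ (symm_le_uniformity (hK.uniformContinuousAt_of_continuousAt u hu hV))]
    with i ⟨hmaps, hinv⟩ hi x hx
  have hV_mem : G i (F i x) ∈ K → (u (G i (F i x)), u (w (F i x))) ∈ V := hi _ (hmaps hx)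
  rw [hinv hx, hw (hmaps hx)] at hV_mem
  exact hV_mem hx

theorem tendstoUniformlyOn_comp {ι α β γ : Type*} [UniformSpace β] [UniformSpace γ]
    {l : Filter ι} {u : α → β} {q : β → γ} {F : ι → α → β} {Q : ι → β → γ} {K : Set α} {L : Set β}
    (hq : UniformContinuousOn q L) (hu : MapsTo u K L) (hF : ∀ᶠ i in l, MapsTo (F i) K L)
    (hQq : TendstoUniformlyOn Q q l L) (hFu : TendstoUniformlyOn F u l K) :
    TendstoUniformlyOn (fun i x => Q i (F i x)) (fun x => q (u x)) l K := by
  intro V hV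
  obtain ⟨W, hW, hWV⟩ := comp_mem_uniformity_sets hV
  filter_upwards [hF, hQq W hW, hq.comp_tendstoUniformlyOn_eventually hF hu hFu W hW]
    with i hmaps hQi hqi x hx
  exact hWV ⟨q (F i x), hqi x hx, hQi (F i x) (hmaps hx)⟩

/-! ### Local solvability of ordinary differential equations -/

theorem exists_hasDerivAt_of_lipschitzOnWith {E : Type*} [NormedAddCommGroup E] [NormedSpace ℝ E]
    [CompleteSpace E] {F : ℝ → E → E} {t₀ δ : ℝ} {x₀ : E} {r L K : NNReal} (hδ : 0 < δ)
    (hr : 0 < r)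
    (hlip : ∀ t ∈ Icc (t₀ - δ) (t₀ + δ), LipschitzOnWith K (F t) (Metric.closedBall x₀ r))
    (hcont : ∀ x ∈ Metric.closedBall x₀ r, ContinuousOn (F · x) (Icc (t₀ - δ) (t₀ + δ)))
    (hbdd : ∀ t ∈ Icc (t₀ - δ) (t₀ + δ), ∀ x ∈ Metric.closedBall x₀ r, ‖F t x‖ ≤ L) :
    ∃ u : ℝ → E, u t₀ = x₀ ∧ ∀ᶠ t in 𝓝 t₀, HasDerivAt u (F t (u t)) t := by
  obtain ⟨ε, hε, hεδ, hLε⟩ : ∃ ε > 0, ε ≤ δ ∧ L * ε ≤ r := by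
    refine ⟨min δ (r / (L + 1)), lt_min hδ (by positivity), min_le_left _ _, ?_⟩
    calc (L : ℝ) * min δ (r / (L + 1)) ≤ (L + 1) * (r / (L + 1)) := by
          gcongr
          · exact le_add_of_nonneg_right zero_le_one
          · exact min_le_right _ _
      _ = r := by field_simp
  have hsub : Icc (t₀ - ε) (t₀ + ε) ⊆ Icc (t₀ - δ) (t₀ + δ) :=
    Icc_subset_Icc (by linarith) (by linarith)
  have hPL : IsPicardLindelof F (tmin := t₀ - ε) (tmax := t₀ + ε)
      ⟨t₀, by linarith, by linarith⟩ x₀ r 0 L K :=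
    ⟨fun t ht => hlip t (hsub ht), fun x hx => (hcont x hx).mono hsub,
      fun t ht => hbdd t (hsub ht), by simpa using hLε⟩
  obtain ⟨u, hu₀, hu⟩ := hPL.exists_eq_forall_mem_Icc_hasDerivWithinAt₀
  refine ⟨u, hu₀, ?_⟩
  filter_upwards [Ioo_mem_nhds (sub_lt_self t₀ hε) (lt_add_of_pos_right t₀ hε)] with t ht
  exact (hu t (Ioo_subset_Icc_self ht)).hasDerivAt (Icc_mem_nhds ht.1 ht.2)

theorem abs_div_sub_div_le {a b p q m : ℝ} (hm : 0 < m) (hp : m ≤ |p|) (hq : m ≤ |q|)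
    (ha : |a| ≤ b) : |a / p - a / q| ≤ b / (m * m) * |p - q| := by
  have hp₀ : p ≠ 0 := abs_pos.1 (hm.trans_le hp)
  have hq₀ : q ≠ 0 := abs_pos.1 (hm.trans_le hq)
  have hdiff : a / p - a / q = a / (p * q) * (q - p) := by field_simp
  rw [hdiff, abs_mul, abs_sub_comm q p, abs_div, abs_mul]
  gcongr
  exact (abs_nonneg a).trans ha

theorem exists_hasDerivAt_div_add {q p : ℝ → ℝ} {s : Set ℝ} {t₀ x₀ : ℝ} (hs : s ∈ 𝓝 t₀)
    (hq : ContinuousOn q s) (hp : ContinuousOn p s) (hne : x₀ + p t₀ ≠ 0) :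
    ∃ u : ℝ → ℝ, u t₀ = x₀ ∧ ∀ᶠ t in 𝓝 t₀, HasDerivAt u (q t / (u t + p t)) t := by
  obtain ⟨m, hm4⟩ : ∃ m : NNReal, |x₀ + p t₀| = 4 * m :=
    ⟨(|x₀ + p t₀| / 4).toNNReal, by rw [Real.coe_toNNReal _ (by positivity)]; ring⟩
  have hm : 0 < m := by
    have := abs_pos.2 hne
    rw [← NNReal.coe_pos]
    linarith
  have hpm : ∀ᶠ t in 𝓝 t₀, |p t - p t₀| < m :=
    (hp.continuousAt hs).eventually (Metric.ball_mem_nhds _ hm)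
  have hqM : ∀ᶠ t in 𝓝 t₀, |q t| < |q t₀| + 1 :=
    (hq.continuousAt hs).abs.eventually_lt_const (lt_add_one _)
  obtain ⟨δ, hδ, hball⟩ := Metric.nhds_basis_closedBall.eventually_iff.1
    (hpm.and (hqM.and hs))
  rw [Real.closedBall_eq_Icc] at hball
  have hden : ∀ t ∈ Icc (t₀ - δ) (t₀ + δ), ∀ x ∈ Metric.closedBall x₀ m, 2 * m ≤ |x + p t| := by
    intro t ht x hx
    have hxm : |x - x₀| ≤ m := hx
    have htri : |x₀ + p t₀| ≤ |x + p t| + |x - x₀| + |p t - p t₀| := by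
      calc |x₀ + p t₀| = |x + p t - (x - x₀) - (p t - p t₀)| := by ring_nf
        _ ≤ _ := (abs_sub _ _).trans (add_le_add_left (abs_sub _ _) _)
    linarith [(hball ht).1]
  have hM : ∀ t ∈ Icc (t₀ - δ) (t₀ + δ), |q t| ≤ (|q t₀| + 1).toNNReal := fun t ht =>
    (hball ht).2.1.le.trans (Real.le_coe_toNNReal _)
  have hsub : Icc (t₀ - δ) (t₀ + δ) ⊆ s := fun t ht => (hball ht).2.2
  have h2m : (0 : ℝ) < 2 * m := by positivity
  refine exists_hasDerivAt_of_lipschitzOnWith (F := fun t x => q t / (x + p t)) hδ hm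
    (K := (|q t₀| + 1).toNNReal / (2 * m * (2 * m))) (L := (|q t₀| + 1).toNNReal / (2 * m))
    (fun t ht => LipschitzOnWith.of_dist_le_mul fun x hx y hy => ?_) (fun x hx => ?_)
    fun t ht x hx => ?_
  · simpa [Real.dist_eq] using
      abs_div_sub_div_le h2m (hden t ht x hx) (hden t ht y hy) (hM t ht)
  · exact (hq.mono hsub).div (continuousOn_const.add (hp.mono hsub)) fun t ht =>
      abs_pos.1 (h2m.trans_le (hden t ht x hx))
  · rw [Real.norm_eq_abs, abs_div]
    push_cast
    gcongr
    exacts [hM t ht, hden t ht x hx]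

/-- Separation of variables: the inverse of an antiderivative of `1 / F` solves `u' = F(u)`. -/
theorem exists_hasDerivAt_of_continuousOn_neg {F : ℝ → ℝ} {s : Set ℝ} {x₀ : ℝ} (hs : IsOpen s)
    (hc : s.OrdConnected) (hF : ContinuousOn F s) (hneg : ∀ x ∈ s, F x < 0) (hx₀ : x₀ ∈ s)
    (t₀ : ℝ) :
    ∃ u : ℝ → ℝ, u t₀ = x₀ ∧ ∀ᶠ t in 𝓝 t₀, u t ∈ s ∧ HasDerivAt u (F (u t)) t := by
  have hinv : ContinuousOn (fun x => (F x)⁻¹) s := hF.inv₀ fun x hx => (hneg x hx).ne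
  obtain ⟨Y, hYx₀, hY⟩ : ∃ Y : ℝ → ℝ, Y x₀ = t₀ ∧ ∀ x ∈ s, HasDerivAt Y (F x)⁻¹ x := by
    refine ⟨fun x => t₀ + ∫ r in x₀..x, (F r)⁻¹, by simp, fun x hx => ?_⟩
    exact (intervalIntegral.integral_hasDerivAt_right
      (hinv.mono (hc.uIcc_subset hx₀ hx)).intervalIntegrable
      (hinv.stronglyMeasurableAtFilter hs x hx)
      (hinv.continuousAt (hs.mem_nhds hx))).const_add t₀
  have hanti : StrictAntiOn Y s := strictAntiOn_of_deriv_neg hc.convex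
    (fun x hx => (hY x hx).continuousAt.continuousWithinAt) fun x hx => by
      rw [(hY x (interior_subset hx)).deriv]
      exact inv_lt_zero.2 (hneg x (interior_subset hx))
  obtain ⟨u, hu⟩ := exists_leftInverse_hasDerivAt hs hY
    (fun x hx => inv_ne_zero (hneg x hx).ne) hinv hanti.injOn
  refine ⟨u, hYx₀ ▸ (hu x₀ hx₀).1, ?_⟩
  have hstrict : HasStrictDerivAt Y (F x₀)⁻¹ x₀ := hasStrictDerivAt_of_hasDerivAt_of_continuousAt
    (eventually_of_mem (hs.mem_nhds hx₀) hY) (hinv.continuousAt (hs.mem_nhds hx₀))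
  rw [← hYx₀, ← hstrict.map_nhds_eq (inv_ne_zero (hneg x₀ hx₀).ne), eventually_map]
  filter_upwards [hs.mem_nhds hx₀] with x hx
  obtain ⟨hux, hux'⟩ := hu x hx
  rw [hux]
  exact ⟨hx, by simpa using hux'⟩

/-! ### Profiles in integrated form -/

/-- The part common to all the conditions on the flux `f`, the diffusivity `D` and the source
term `g`: in this class the behavior of `D` and `g` at the end points is unrestricted. -/
structure Coefficients (ρbar : ℝ) (f D g : ℝ → ℝ) : Prop where
  pos : 0 < ρbar
  flux : ContDiffOn ℝ 1 f (Icc 0 ρbar)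
  diff : ContinuousOn D (Icc 0 ρbar)
  diff_pos : ∀ ρ ∈ Ioo 0 ρbar, 0 < D ρ
  source : ContinuousOn g (Icc 0 ρbar)
  source_pos : ∀ ρ ∈ Ioo 0 ρbar, 0 < g ρ

/-- A traveling-wave profile `φ` on `I` issuing from `ρbar`, with the equation integrated once:
`v` is an antiderivative of `-g(φ)` and `D(φ) φ' = v + f(φ) - c φ` at each point of
differentiability. -/
structure FluxProfile (ρbar : ℝ) (f D g : ℝ → ℝ) (c : ℝ) (I : Set ℝ) (φ v : ℝ → ℝ) : Prop where
  isOpen : IsOpen I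
  isLowerSet : IsLowerSet I
  nonempty : I.Nonempty
  mapsTo : MapsTo φ I (Icc 0 ρbar)
  continuousOn : ContinuousOn φ I
  hasDerivAt_flux : ∀ ξ ∈ I, HasDerivAt v (-g (φ ξ)) ξ
  differentiableAt : ∀ ξ ∈ I, φ ξ ∈ Ioo 0 ρbar → DifferentiableAt ℝ φ ξ
  flux_eq : ∀ ξ ∈ I, DifferentiableAt ℝ φ ξ →
    D (φ ξ) * deriv φ ξ = v ξ + f (φ ξ) - c * φ ξ
  tendsto : Tendsto φ atBot (𝓝 ρbar)

/-- The points of `I` where `0 < φ < ρbar`; there the equation is nondegenerate. -/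
def activeSet (ρbar : ℝ) (I : Set ℝ) (φ : ℝ → ℝ) : Set ℝ := I ∩ φ ⁻¹' Ioo 0 ρbar

variable {ρbar : ℝ} {f D g : ℝ → ℝ} {c : ℝ} {I : Set ℝ} {φ v : ℝ → ℝ}

theorem continuousOn_and_pos_of_condDhat_or_condDtilde
    (hD : CondDhat ρbar D ∨ CondDtilde ρbar D g) :
    ContinuousOn D (Icc 0 ρbar) ∧ ∀ ρ ∈ Ioo 0 ρbar, 0 < D ρ :=
  hD.elim (fun h => ⟨h.contDiffOn.continuousOn, h.pos⟩) fun h => ⟨h.continuousOn, h.pos⟩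

theorem Coefficients.source_nonneg (H : Coefficients ρbar f D g) :
    ∀ ρ ∈ Icc 0 ρbar, 0 ≤ g ρ := by
  rw [← closure_Ioo H.pos.ne]
  refine le_on_closure (fun ρ hρ => (H.source_pos ρ hρ).le) continuousOn_const ?_
  rw [closure_Ioo H.pos.ne]
  exact H.source

theorem hasDerivAt_h (hf : ContDiffOn ℝ 1 f (Icc 0 ρbar)) {ρ : ℝ} (hρ : ρ ∈ Ioo 0 ρbar) :
    HasDerivAt f (h ρbar f ρ) ρ :=
  (hf.differentiableOn one_ne_zero ρ (Ioo_subset_Icc_self hρ)).hasDerivWithinAt.hasDerivAt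
    (Icc_mem_nhds hρ.1 hρ.2)

theorem IsTravelingWave.exists_flux (hf : ContinuousOn f (Icc 0 ρbar))
    (hg : ContinuousOn g (Icc 0 ρbar)) (hφ : IsTravelingWave ρbar f D g c I φ) (hne : I.Nonempty)
    (hcl : IsClassicalOrSharp ρbar f D g c I φ) :
    ∃ v : ℝ → ℝ, (∀ ξ ∈ I, HasDerivAt v (-g (φ ξ)) ξ) ∧
      ∀ ξ ∈ I, DifferentiableAt ℝ φ ξ → D (φ ξ) * deriv φ ξ = v ξ + f (φ ξ) - c * φ ξ := by
  obtain ⟨S, hS, -, hsharp, hclassical⟩ := hcl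
  have hfφ : ContinuousOn (fun ξ => f (φ ξ)) I := hf.comp hφ.continuousOn hφ.mapsTo
  have hgφ : ContinuousOn (fun ξ => g (φ ξ)) I := hg.comp hφ.continuousOn hφ.mapsTo
  have hcφ : ContinuousOn (fun ξ => c * φ ξ) I := continuousOn_const.mul hφ.continuousOn
  have hmeas := hφ.isOpen.measurableSet
  obtain ⟨v, hv, hae⟩ := exists_antiderivative_of_weak hφ.isOpen hφ.ordConnected hne
    (w := fun ξ => D (φ ξ) * deriv φ ξ - f (φ ξ) + c * φ ξ)
    ((hφ.locallyIntegrableOn.sub (hfφ.locallyIntegrableOn hmeas)).add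
      (hcφ.locallyIntegrableOn hmeas)) hgφ hφ.weak
  have hopen : IsOpen (I \ S) := hφ.isOpen.sdiff hS.isClosed
  have hvc : ContinuousOn v I := fun ξ hξ => (hv ξ hξ).continuousAt.continuousWithinAt
  have heq : EqOn (fun ξ => D (φ ξ) * deriv φ ξ) (fun ξ => v ξ + f (φ ξ) - c * φ ξ) (I \ S) := by
    refine Measure.eqOn_open_of_ae_eq (μ := volume) ?_ hopen
      (continuousOn_of_absolutelyContinuousOnInterval hopen hclassical.absolutelyContinuous)
      (((hvc.add hfφ).sub hcφ).mono sdiff_subset)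
    filter_upwards [ae_restrict_of_ae_restrict_of_subset sdiff_subset hae] with ξ hξ
    linarith
  exact ⟨v, hv, fun ξ hξ hd => heq ⟨hξ, fun hs => (hsharp ξ hs).2 hd⟩⟩

theorem IsTravelingWave.exists_fluxProfile (H : Coefficients ρbar f D g)
    (hφ : IsTravelingWave ρbar f D g c I φ) (hcl : IsClassicalOrSharp ρbar f D g c I φ)
    (hlow : IsLowerSet I) (hne : I.Nonempty) (hlim : Tendsto φ atBot (𝓝 ρbar)) :
    ∃ v, FluxProfile ρbar f D g c I φ v := by
  obtain ⟨v, hv, heq⟩ := hφ.exists_flux H.flux.continuousOn H.source hne hcl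
  obtain ⟨S, -, -, hsharp, hclassical⟩ := hcl
  exact ⟨v, hφ.isOpen, hlow, hne, hφ.mapsTo, hφ.continuousOn, hv, fun ξ hξ hφξ =>
    hclassical.differentiableAt ξ ⟨hξ, fun hs => (H.source_pos _ hφξ).ne' (hsharp ξ hs).1⟩,
    heq, hlim⟩

namespace FluxProfile

theorem antitoneOn_flux (H : Coefficients ρbar f D g) (P : FluxProfile ρbar f D g c I φ v) :
    AntitoneOn v I := by
  refine antitoneOn_of_hasDerivWithinAt_nonpos P.isLowerSet.ordConnected.convex
    (fun x hx => (P.hasDerivAt_flux x hx).continuousAt.continuousWithinAt)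
    (fun x hx => (P.hasDerivAt_flux x (interior_subset hx)).hasDerivWithinAt) fun x hx => ?_
  exact neg_nonpos.2 (H.source_nonneg _ (P.mapsTo (interior_subset hx)))

/-- If `φ` increased, it would cross some level `ρ ∈ (0, ρbar)` downwards at `y` and upwards at a
later point `x`, so that `v y ≤ v x`; but `v` is nonincreasing, and `v' y = -g ρ < 0`. -/
theorem antitoneOn (H : Coefficients ρbar f D g) (P : FluxProfile ρbar f D g c I φ v) :
    AntitoneOn φ I := by
  intro a ha b hb hab
  by_contra! hlt
  obtain ⟨ρ, hρa, hρb⟩ := exists_between hlt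
  have hρ : ρ ∈ Ioo 0 ρbar := ⟨(P.mapsTo ha).1.trans_lt hρa, hρb.trans_le (P.mapsTo hb).2⟩
  obtain ⟨e, hρe, hea⟩ := ((P.tendsto.eventually_const_lt hρ.2).and (eventually_le_atBot a)).exists
  have hcont : ∀ s ≤ b, ∀ r, ContinuousOn φ (Icc r s) := fun s hs r =>
    P.continuousOn.mono fun t ht => P.isLowerSet (ht.2.trans hs) hb
  obtain ⟨y, hy, hφy, hy_lt⟩ := exists_last_crossing hea (hcont a hab e) hρe.le hρa
  obtain ⟨x, hx, hφx, hx_lt⟩ := exists_first_crossing hab (hcont b le_rfl a) hρa hρb.le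
  have hyI : y ∈ I := P.isLowerSet hy.2.le ha
  have hxI : x ∈ I := P.isLowerSet hx.2 hb
  have hdy := P.differentiableAt y hyI (by rwa [hφy])
  have hdx := P.differentiableAt x hxI (by rwa [hφx])
  have hφ'y : deriv φ y ≤ 0 := nonpos_of_isLocalMaxOn_Ioi hdy.hasDerivAt <| by
    filter_upwards [Ioc_mem_nhdsGT hy.2] with t ht using hφy ▸ (hy_lt t ht).le
  have hφ'x : 0 ≤ deriv φ x := nonneg_of_isLocalMaxOn_Iio hdx.hasDerivAt <| by
    filter_upwards [Ico_mem_nhdsLT hx.1] with t ht using hφx ▸ (hx_lt t ht).le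
  have hvyx : v y ≤ v x := by
    have hfy := P.flux_eq y hyI hdy
    have hfx := P.flux_eq x hxI hdx
    rw [hφy] at hfy
    rw [hφx] at hfx
    linarith [mul_nonpos_of_nonneg_of_nonpos (H.diff_pos ρ hρ).le hφ'y,
      mul_nonneg (H.diff_pos ρ hρ).le hφ'x]
  have hg : - -g (φ y) ≤ 0 := by
    refine nonpos_of_isLocalMaxOn_Ioi (P.hasDerivAt_flux y hyI).fun_neg ?_
    filter_upwards [Ioc_mem_nhdsGT (hy.2.trans hx.1)] with t ht
    exact neg_le_neg (hvyx.trans (P.antitoneOn_flux H (P.isLowerSet ht.2 hxI) hxI ht.2))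
  rw [neg_neg, hφy] at hg
  exact hg.not_gt (H.source_pos ρ hρ)

theorem isOpen_activeSet (P : FluxProfile ρbar f D g c I φ v) : IsOpen (activeSet ρbar I φ) :=
  P.continuousOn.isOpen_inter_preimage P.isOpen isOpen_Ioo

theorem ordConnected_activeSet (H : Coefficients ρbar f D g)
    (P : FluxProfile ρbar f D g c I φ v) : (activeSet ρbar I φ).OrdConnected := by
  refine ⟨fun x hx y hy t ht => ?_⟩
  have htI : t ∈ I := P.isLowerSet ht.2 hy.1
  exact ⟨htI, hy.2.1.trans_le (P.antitoneOn H htI hy.1 ht.2),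
    (P.antitoneOn H hx.1 htI ht.1).trans_lt hx.2.2⟩

theorem hasDerivAt (H : Coefficients ρbar f D g) (P : FluxProfile ρbar f D g c I φ v) {ξ : ℝ}
    (hξ : ξ ∈ activeSet ρbar I φ) :
    HasDerivAt φ ((v ξ + f (φ ξ) - c * φ ξ) / D (φ ξ)) ξ := by
  have hd := P.differentiableAt ξ hξ.1 hξ.2
  rw [← P.flux_eq ξ hξ.1 hd, mul_div_cancel_left₀ _ (H.diff_pos _ hξ.2).ne']
  exact hd.hasDerivAt

theorem hasDerivAt_diff_mul_deriv (hf : ContDiffOn ℝ 1 f (Icc 0 ρbar))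
    (P : FluxProfile ρbar f D g c I φ v) {ξ : ℝ} (hξ : ξ ∈ activeSet ρbar I φ) :
    HasDerivAt (fun t => D (φ t) * deriv φ t)
      (-((c - h ρbar f (φ ξ)) * deriv φ ξ + g (φ ξ))) ξ := by
  have hd := (P.differentiableAt ξ hξ.1 hξ.2).hasDerivAt
  have hderiv := ((P.hasDerivAt_flux ξ hξ.1).fun_add
    ((hasDerivAt_h hf hξ.2).comp ξ hd)).fun_sub (hd.const_mul c)
  refine (hderiv.congr_of_eventuallyEq ?_).congr_deriv (by ring)
  filter_upwards [P.isOpen_activeSet.mem_nhds hξ] with t ht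
  exact P.flux_eq t ht.1 (P.differentiableAt t ht.1 ht.2)

theorem deriv_neg (H : Coefficients ρbar f D g) (P : FluxProfile ρbar f D g c I φ v) {ξ : ℝ}
    (hξ : ξ ∈ activeSet ρbar I φ) : deriv φ ξ < 0 := by
  have hnonpos : ∀ t ∈ activeSet ρbar I φ, deriv φ t ≤ 0 := fun t ht =>
    nonpos_of_isLocalMaxOn_Ioi (P.differentiableAt t ht.1 ht.2).hasDerivAt <| by
      filter_upwards [mem_nhdsWithin_of_mem_nhds (P.isOpen.mem_nhds ht.1), self_mem_nhdsWithin]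
        with s hs hts using P.antitoneOn H ht.1 hs (le_of_lt hts)
  refine lt_of_le_of_ne (hnonpos ξ hξ) fun hzero => ?_
  have hmax := nonneg_of_isLocalMaxOn_Iio (P.hasDerivAt_diff_mul_deriv H.flux hξ) <| by
    filter_upwards [mem_nhdsWithin_of_mem_nhds (P.isOpen_activeSet.mem_nhds hξ)] with s hs
    rw [hzero, mul_zero]
    exact mul_nonpos_of_nonneg_of_nonpos (H.diff_pos _ hs.2).le (hnonpos s hs)
  rw [hzero, mul_zero, zero_add] at hmax
  linarith [H.source_pos _ hξ.2]

theorem continuousOn_deriv (H : Coefficients ρbar f D g) (P : FluxProfile ρbar f D g c I φ v) :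
    ContinuousOn (deriv φ) (activeSet ρbar I φ) := by
  have hφ : ContinuousOn φ (activeSet ρbar I φ) := P.continuousOn.mono inter_subset_left
  have hmaps : MapsTo φ (activeSet ρbar I φ) (Icc 0 ρbar) := P.mapsTo.mono_left inter_subset_left
  have hv : ContinuousOn v (activeSet ρbar I φ) := fun ξ hξ =>
    (P.hasDerivAt_flux ξ hξ.1).continuousAt.continuousWithinAt
  refine ContinuousOn.congr (f := fun ξ => (v ξ + f (φ ξ) - c * φ ξ) / D (φ ξ)) ?_
    fun ξ hξ => (P.hasDerivAt H hξ).deriv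
  exact ((hv.add (H.flux.continuousOn.comp hφ hmaps)).sub (continuousOn_const.mul hφ)).div
    (H.diff.comp hφ hmaps) fun ξ hξ => (H.diff_pos _ hξ.2).ne'

theorem contDiffOn (H : Coefficients ρbar f D g) (P : FluxProfile ρbar f D g c I φ v) :
    ContDiffOn ℝ 1 φ (activeSet ρbar I φ) := by
  rw [← zero_add (1 : WithTop ℕ∞), contDiffOn_succ_iff_deriv_of_isOpen P.isOpen_activeSet]
  exact ⟨fun x hx => (P.differentiableAt x hx.1 hx.2).differentiableWithinAt, by simp,
    contDiffOn_zero.2 (P.continuousOn_deriv H)⟩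

theorem strictAntiOn (H : Coefficients ρbar f D g) (P : FluxProfile ρbar f D g c I φ v) :
    StrictAntiOn φ (activeSet ρbar I φ) :=
  strictAntiOn_of_deriv_neg (P.ordConnected_activeSet H).convex
    (P.continuousOn.mono inter_subset_left) fun _ hx => P.deriv_neg H (interior_subset hx)

theorem flux_eq_of_eq_right (H : Coefficients ρbar f D g) (P : FluxProfile ρbar f D g c I φ v)
    {y : ℝ} (hy : y ∈ I) (hφy : φ y = ρbar) : v y = c * ρbar - f ρbar := by
  have hconst : ∀ t < y, φ t = ρbar := fun t ht =>
    have htI := P.isLowerSet ht.le hy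
    le_antisymm (P.mapsTo htI).2 (hφy ▸ P.antitoneOn H htI hy ht.le)
  have hv : Tendsto v (𝓝[<] y) (𝓝 (v y)) :=
    (P.hasDerivAt_flux y hy).continuousAt.tendsto.mono_left nhdsWithin_le_nhds
  refine tendsto_nhds_unique hv (tendsto_const_nhds.congr' ?_)
  filter_upwards [self_mem_nhdsWithin] with t ht
  have hd : HasDerivAt φ 0 t := (hasDerivAt_const t ρbar).congr_of_eventuallyEq
    (eventually_of_mem (Iio_mem_nhds ht) hconst)
  have heq := P.flux_eq t (P.isLowerSet (le_of_lt ht) hy) hd.differentiableAt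
  rw [hd.deriv, hconst t ht] at heq
  linarith

theorem exists_flux_gt_of_eq_right (H : Coefficients ρbar f D g)
    (P : FluxProfile ρbar f D g c I φ v) {p s : ℝ} (hp : p ∈ activeSet ρbar I φ) (hs : s ∈ I)
    (hφs : φ s = ρbar) {ε : ℝ} (hε : 0 < ε) :
    ∃ x ∈ activeSet ρbar I φ, c * ρbar - f ρbar - ε < v x := by
  have hsp : s ≤ p := by
    by_contra! hps
    exact hp.2.2.not_ge (hφs ▸ P.antitoneOn H hp.1 hs hps.le)
  obtain ⟨y, hy, hφy, hlt⟩ := exists_last_crossing hsp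
    (P.continuousOn.mono fun t ht => P.isLowerSet ht.2 hp.1) hφs.ge hp.2.2
  have hyI : y ∈ I := P.isLowerSet hy.2.le hp.1
  have hv : ∀ᶠ t in 𝓝[>] y, c * ρbar - f ρbar - ε < v t := by
    refine ((P.hasDerivAt_flux y hyI).continuousAt.tendsto.mono_left
      nhdsWithin_le_nhds).eventually_const_lt ?_
    rw [P.flux_eq_of_eq_right H hyI hφy]
    exact sub_lt_self _ hε
  obtain ⟨x, hvx, hx⟩ := (hv.and (Ioc_mem_nhdsGT hy.2)).exists
  have hxI : x ∈ I := P.isLowerSet hx.2 hp.1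
  exact ⟨x, ⟨hxI, hp.2.1.trans_le (P.antitoneOn H hxI hp.1 hx.2), hlt x hx⟩, hvx⟩

theorem exists_flux_gt_of_Iic_subset (H : Coefficients ρbar f D g)
    (P : FluxProfile ρbar f D g c I φ v) {p : ℝ} (hp : Iic p ⊆ activeSet ρbar I φ) {ε : ℝ}
    (hε : 0 < ε) : ∃ x ∈ activeSet ρbar I φ, c * ρbar - f ρbar - ε < v x := by
  obtain ⟨x, hxp, hx, hderiv⟩ := exists_seq_tendsto_deriv_zero_of_tendsto_atBot
    (fun t ht => P.differentiableAt t (hp ht).1 (hp ht).2) P.tendsto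
  have hact : ∀ n, x n ∈ activeSet ρbar I φ := fun n => hp (hxp n)
  have hφ : Tendsto (fun n => φ (x n)) atTop (𝓝 ρbar) := P.tendsto.comp hx
  have hφ_within : Tendsto (fun n => φ (x n)) atTop (𝓝[Icc 0 ρbar] ρbar) :=
    tendsto_nhdsWithin_iff.2 ⟨hφ, Eventually.of_forall fun n => P.mapsTo (hact n).1⟩
  have hr : ρbar ∈ Icc 0 ρbar := right_mem_Icc.2 H.pos.le
  have hv : Tendsto (fun n => v (x n)) atTop (𝓝 (D ρbar * 0 - f ρbar + c * ρbar)) := by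
    refine (((((H.diff ρbar hr).tendsto.comp hφ_within).mul hderiv).sub
      ((H.flux.continuousOn ρbar hr).tendsto.comp hφ_within)).add (hφ.const_mul c)).congr
      fun n => ?_
    have := P.flux_eq (x n) (hact n).1 (P.differentiableAt _ (hact n).1 (hact n).2)
    simp only [Function.comp_apply]
    linarith
  obtain ⟨n, hn⟩ := (hv.eventually_const_lt (u := c * ρbar - f ρbar - ε) (by linarith)).exists
  exact ⟨x n, hact n, hn⟩

theorem exists_flux_gt (H : Coefficients ρbar f D g) (P : FluxProfile ρbar f D g c I φ v)
    {p : ℝ} (hp : p ∈ activeSet ρbar I φ) {ε : ℝ} (hε : 0 < ε) :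
    ∃ x ∈ activeSet ρbar I φ, c * ρbar - f ρbar - ε < v x := by
  by_cases hright : ∃ s ∈ I, φ s = ρbar
  · obtain ⟨s, hs, hφs⟩ := hright
    exact P.exists_flux_gt_of_eq_right H hp hs hφs hε
  · push Not at hright
    refine P.exists_flux_gt_of_Iic_subset H (p := p) (fun t ht => ?_) hε
    have htI := P.isLowerSet ht hp.1
    exact ⟨htI, hp.2.1.trans_le (P.antitoneOn H htI hp.1 ht),
      (P.mapsTo htI).2.lt_of_ne (hright t htI)⟩

end FluxProfile

/-! ### The phase plane -/

/-- A profile seen in the phase plane: as functions of the density, `y` is the inverse of the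
profile and `Z = D(φ) φ'`, hence `Z' = h - c - g D / Z` and `y' = D / Z`. -/
structure PhaseTrajectory (ρbar : ℝ) (f D g : ℝ → ℝ) (c : ℝ) (y Z : ℝ → ℝ) : Prop where
  neg : ∀ ρ ∈ Ioo 0 ρbar, Z ρ < 0
  hasDerivAt : ∀ ρ ∈ Ioo 0 ρbar,
    HasDerivAt (fun r => Z r - f r + c * r) (-(g ρ * D ρ / Z ρ)) ρ
  hasDerivAt_inverse : ∀ ρ ∈ Ioo 0 ρbar, HasDerivAt y (D ρ / Z ρ) ρ
  tendsto : Tendsto Z (𝓝[<] ρbar) (𝓝 0)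

section

variable {ρbar : ℝ} {f D g : ℝ → ℝ} {c : ℝ} {I : Set ℝ} {φ v : ℝ → ℝ}

theorem FluxProfile.exists_inverse (H : Coefficients ρbar f D g)
    (P : FluxProfile ρbar f D g c I φ v) (hsurj : SurjOn φ I (Ioo 0 ρbar)) :
    ∃ y : ℝ → ℝ, ∀ ρ ∈ Ioo 0 ρbar,
      y ρ ∈ activeSet ρbar I φ ∧ φ (y ρ) = ρ ∧ HasDerivAt y (deriv φ (y ρ))⁻¹ ρ := by
  obtain ⟨y, hy⟩ := exists_leftInverse_hasDerivAt P.isOpen_activeSet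
    (fun x hx => (P.differentiableAt x hx.1 hx.2).hasDerivAt) (fun x hx => (P.deriv_neg H hx).ne)
    (P.continuousOn_deriv H) (P.strictAntiOn H).injOn
  refine ⟨y, fun ρ hρ => ?_⟩
  obtain ⟨x, hx, rfl⟩ := hsurj hρ
  obtain ⟨hyx, hy'⟩ := hy x ⟨hx, hρ⟩
  rw [hyx]
  exact ⟨⟨hx, hρ⟩, rfl, hy'⟩

theorem FluxProfile.diff_mul_deriv_eq (P : FluxProfile ρbar f D g c I φ v) {x ρ : ℝ}
    (hx : x ∈ activeSet ρbar I φ) (hφx : φ x = ρ) :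
    D ρ * deriv φ x = v x + f ρ - c * ρ := by
  subst hφx
  exact P.flux_eq x hx.1 (P.differentiableAt x hx.1 hx.2)

theorem FluxProfile.tendsto_diff_mul_deriv_inverse (H : Coefficients ρbar f D g)
    (P : FluxProfile ρbar f D g c I φ v) {y : ℝ → ℝ}
    (hy : ∀ ρ ∈ Ioo 0 ρbar, y ρ ∈ activeSet ρbar I φ ∧ φ (y ρ) = ρ) :
    Tendsto (fun ρ => D ρ * deriv φ (y ρ)) (𝓝[<] ρbar) (𝓝 0) := by
  have hf : Tendsto f (𝓝[<] ρbar) (𝓝 (f ρbar)) := by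
    rw [← nhdsWithin_Ioo_eq_nhdsLT H.pos]
    exact (H.flux.continuousOn ρbar (right_mem_Icc.2 H.pos.le)).mono_left
      (nhdsWithin_mono _ Ioo_subset_Icc_self)
  have hlim : Tendsto (fun r => f r - f ρbar - c * (r - ρbar)) (𝓝[<] ρbar) (𝓝 0) := by
    have hid : Tendsto (fun r : ℝ => r) (𝓝[<] ρbar) (𝓝 ρbar) := nhdsWithin_le_nhds
    simpa using (hf.sub_const (f ρbar)).sub ((hid.sub_const ρbar).const_mul c)
  rw [Metric.tendsto_nhds]
  intro ε hε
  obtain ⟨x, hx, hvx⟩ := P.exists_flux_gt H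
    (hy (ρbar / 2) ⟨half_pos H.pos, half_lt_self H.pos⟩).1 (half_pos hε)
  filter_upwards [hlim.eventually_const_lt (neg_lt_zero.2 (half_pos hε)),
    Ioo_mem_nhdsLT hx.2.2] with r hr hφr
  obtain ⟨hyr, hφyr⟩ := hy r ⟨hx.2.1.trans hφr.1, hφr.2⟩
  have hyx : y r ≤ x := by
    by_contra! hxy
    exact hφr.1.not_gt (hφyr ▸ P.strictAntiOn H hx hyr hxy)
  have hneg : D r * deriv φ (y r) < 0 :=
    mul_neg_of_pos_of_neg (hφyr ▸ H.diff_pos _ hyr.2) (P.deriv_neg H hyr)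
  rw [Real.dist_eq, sub_zero, abs_of_neg hneg, P.diff_mul_deriv_eq hyr hφyr]
  linarith [P.antitoneOn_flux H hyr.1 hx.1 hyx]

theorem FluxProfile.exists_phaseTrajectory (H : Coefficients ρbar f D g)
    (P : FluxProfile ρbar f D g c I φ v) (hsurj : SurjOn φ I (Ioo 0 ρbar)) :
    ∃ y Z : ℝ → ℝ, PhaseTrajectory ρbar f D g c y Z ∧
      InvOn y φ (activeSet ρbar I φ) (Ioo 0 ρbar) ∧
      EqOn (deriv φ) (fun x => Z (φ x) / D (φ x)) (activeSet ρbar I φ) := by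
  obtain ⟨y, hy⟩ := P.exists_inverse H hsurj
  have hyφ : LeftInvOn y φ (activeSet ρbar I φ) := fun x hx =>
    (P.strictAntiOn H).injOn (hy _ hx.2).1 hx (hy _ hx.2).2.1
  have hderiv : ∀ ρ ∈ Ioo 0 ρbar, HasDerivAt y (D ρ / (D ρ * deriv φ (y ρ))) ρ := fun ρ hρ =>
    (hy ρ hρ).2.2.congr_deriv (by
      have hD := (H.diff_pos ρ hρ).ne'
      field_simp)
  refine ⟨y, fun ρ => D ρ * deriv φ (y ρ), ⟨fun ρ hρ => ?_, fun ρ hρ => ?_, hderiv,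
    P.tendsto_diff_mul_deriv_inverse H fun ρ hρ => ⟨(hy ρ hρ).1, (hy ρ hρ).2.1⟩⟩,
    ⟨hyφ, fun ρ hρ => (hy ρ hρ).2.1⟩, fun x hx => ?_⟩
  · exact mul_neg_of_pos_of_neg (H.diff_pos ρ hρ) (P.deriv_neg H (hy ρ hρ).1)
  · have hv := (P.hasDerivAt_flux (y ρ) (hy ρ hρ).1.1).comp ρ (hderiv ρ hρ)
    rw [(hy ρ hρ).2.1] at hv
    refine (hv.congr_of_eventuallyEq ?_).congr_deriv (by ring)
    filter_upwards [isOpen_Ioo.mem_nhds hρ] with r hr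
    rw [P.diff_mul_deriv_eq (hy r hr).1 (hy r hr).2.1, Function.comp_apply]
    ring
  · simp only [hyφ hx]
    rw [mul_div_cancel_left₀ _ (H.diff_pos _ hx.2).ne']

end

/-! ### Extension of profiles -/

/-- The first-order system `D(φ) φ' = v + f(φ) - c φ`, `v' = -g(φ)`, satisfied at a point where the
equation is nondegenerate. -/
structure SolvesSystemAt (ρbar : ℝ) (f D g : ℝ → ℝ) (c : ℝ) (φ v : ℝ → ℝ) (t : ℝ) : Prop where
  mem : φ t ∈ Ioo 0 ρbar
  hasDerivAt : HasDerivAt φ ((v t + f (φ t) - c * φ t) / D (φ t)) t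
  hasDerivAt_flux : HasDerivAt v (-g (φ t)) t

section

variable {ρbar : ℝ} {f D g : ℝ → ℝ} {c : ℝ}

/-- Since `g` and `D` are only continuous the system is solved through the phase plane: first `v` as
a function `V` of the density, by `V' = -g D / (V + f - c ρ)`, then the density by separation of
variables. -/
theorem exists_eventually_solvesSystemAt {ℓ V₀ : ℝ} (H : Coefficients ρbar f D g)
    (hℓ : ℓ ∈ Ioo 0 ρbar) (hV₀ : V₀ + f ℓ - c * ℓ < 0) (t₀ : ℝ) :
    ∃ ψ w : ℝ → ℝ, ψ t₀ = ℓ ∧ w t₀ = V₀ ∧ ∀ᶠ t in 𝓝 t₀, SolvesSystemAt ρbar f D g c ψ w t := by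
  have hp : ContinuousOn (fun r => f r - c * r) (Icc 0 ρbar) :=
    H.flux.continuousOn.sub (continuousOn_const.mul continuousOn_id)
  obtain ⟨V, hVℓ, hV⟩ := exists_hasDerivAt_div_add (Icc_mem_nhds hℓ.1 hℓ.2)
    (H.source.mul H.diff).neg hp (x₀ := V₀) (by linarith)
  have hV_neg : ∀ᶠ r in 𝓝 ℓ, V r + (f r - c * r) < 0 :=
    (hV.self_of_nhds.continuousAt.add
      (hp.continuousAt (Icc_mem_nhds hℓ.1 hℓ.2))).eventually_lt_const
        (by simp only [Pi.add_apply, hVℓ]; linarith)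
  obtain ⟨ε, hε, hball⟩ := Metric.eventually_nhds_iff_ball.1
    (hV.and (hV_neg.and (isOpen_Ioo.mem_nhds hℓ)))
  rw [Real.ball_eq_Ioo] at hball
  set C := Ioo (ℓ - ε) (ℓ + ε)
  have hsub : C ⊆ Icc 0 ρbar := fun r hr => Ioo_subset_Icc_self (hball r hr).2.2
  have hVc : ContinuousOn V C := fun r hr => (hball r hr).1.continuousAt.continuousWithinAt
  obtain ⟨ψ, hψt₀, hψ⟩ := exists_hasDerivAt_of_continuousOn_neg
    (F := fun r => (V r + (f r - c * r)) / D r) isOpen_Ioo ordConnected_Ioo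
    ((hVc.add (hp.mono hsub)).div (H.diff.mono hsub)
      fun r hr => (H.diff_pos r (hball r hr).2.2).ne')
    (fun r hr => div_neg_of_neg_of_pos (hball r hr).2.1 (H.diff_pos r (hball r hr).2.2))
    (x₀ := ℓ) ⟨sub_lt_self ℓ hε, lt_add_of_pos_right ℓ hε⟩ t₀
  refine ⟨ψ, V ∘ ψ, hψt₀, by rw [Function.comp_apply, hψt₀, hVℓ], ?_⟩
  filter_upwards [hψ] with t ⟨htC, ht⟩
  obtain ⟨hVt, hneg, hmem⟩ := hball (ψ t) htC
  refine ⟨hmem, ht.congr_deriv (by simp only [Function.comp_apply, add_sub_assoc]),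
    (hVt.comp t ht).congr_deriv ?_⟩
  have hD := (H.diff_pos _ hmem).ne'
  have hZ := hneg.ne
  simp only [Pi.neg_apply, Pi.mul_apply]
  field_simp

end

variable {ρbar : ℝ} {f D g : ℝ → ℝ} {c : ℝ} {φ v ψ w : ℝ → ℝ}

theorem SolvesSystemAt.congr {t : ℝ} (hφ : SolvesSystemAt ρbar f D g c φ v t) (hψ : ψ =ᶠ[𝓝 t] φ)
    (hw : w =ᶠ[𝓝 t] v) : SolvesSystemAt ρbar f D g c ψ w t := by
  refine ⟨?_, ?_, ?_⟩ <;> rw [hψ.eq_of_nhds]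
  · exact hφ.mem
  · rw [hw.eq_of_nhds]
    exact hφ.hasDerivAt.congr_of_eventuallyEq hψ
  · exact hφ.hasDerivAt_flux.congr_of_eventuallyEq hw

theorem tendsto_add_flux_sub {ℓ V₀ : ℝ} {l : Filter ℝ} (hf : ContinuousAt f ℓ)
    (hφ : Tendsto φ l (𝓝 ℓ)) (hv : Tendsto v l (𝓝 V₀)) :
    Tendsto (fun t => v t + f (φ t) - c * φ t) l (𝓝 (V₀ + f ℓ - c * ℓ)) :=
  (hv.add (hf.tendsto.comp hφ)).sub (hφ.const_mul c)

theorem SolvesSystemAt.ite (H : Coefficients ρbar f D g) {ϖ : ℝ}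
    (hleft : ∀ᶠ t in 𝓝[<] ϖ, SolvesSystemAt ρbar f D g c φ v t)
    (hright : SolvesSystemAt ρbar f D g c ψ w ϖ) (hφ : Tendsto φ (𝓝[<] ϖ) (𝓝 (ψ ϖ)))
    (hv : Tendsto v (𝓝[<] ϖ) (𝓝 (w ϖ))) :
    SolvesSystemAt ρbar f D g c (fun t => if t < ϖ then φ t else ψ t)
      (fun t => if t < ϖ then v t else w t) ϖ := by
  have hnhds : Icc 0 ρbar ∈ 𝓝 (ψ ϖ) := Icc_mem_nhds hright.mem.1 hright.mem.2
  have hφ' : Tendsto (fun t => (v t + f (φ t) - c * φ t) / D (φ t)) (𝓝[<] ϖ)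
      (𝓝 ((w ϖ + f (ψ ϖ) - c * ψ ϖ) / D (ψ ϖ))) :=
    (tendsto_add_flux_sub (H.flux.continuousOn.continuousAt hnhds) hφ hv).div
      ((H.diff.continuousAt hnhds).tendsto.comp hφ) (H.diff_pos _ hright.mem).ne'
  have hv' : Tendsto (fun t => -g (φ t)) (𝓝[<] ϖ) (𝓝 (-g (ψ ϖ))) :=
    ((H.source.continuousAt hnhds).tendsto.comp hφ).neg
  refine ⟨?_, ?_, ?_⟩ <;> simp only [lt_irrefl, if_false]
  · exact hright.mem
  · exact hasDerivAt_ite_of_tendsto (hleft.mono fun t ht => ht.hasDerivAt) hφ hφ' hright.hasDerivAt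
  · exact hasDerivAt_ite_of_tendsto (hleft.mono fun t ht => ht.hasDerivAt_flux) hv hv'
      hright.hasDerivAt_flux

namespace FluxProfile

theorem solvesSystemAt (H : Coefficients ρbar f D g) {I : Set ℝ}
    (P : FluxProfile ρbar f D g c I φ v) {ξ : ℝ} (hξ : ξ ∈ activeSet ρbar I φ) :
    SolvesSystemAt ρbar f D g c φ v ξ :=
  ⟨hξ.2, P.hasDerivAt H hξ, P.hasDerivAt_flux ξ hξ.1⟩

theorem exists_tendsto_flux (H : Coefficients ρbar f D g) {ϖ : ℝ}
    (P : FluxProfile ρbar f D g c (Iio ϖ) φ v) : ∃ V₀, Tendsto v (𝓝[<] ϖ) (𝓝 V₀) := by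
  obtain ⟨M, hM⟩ := isCompact_Icc.exists_bound_of_continuousOn H.source
  refine exists_tendsto_nhdsLT_of_hasDerivAt_bounded (M := M) P.hasDerivAt_flux fun t ht => ?_
  rw [abs_neg]
  exact hM _ (P.mapsTo ht)

/-- If the limit of `D(φ) φ' < 0` were `0`, then `φ' → 0`, so that `(D(φ) φ')' → -g ℓ < 0`. -/
theorem add_flux_sub_neg_of_tendsto (H : Coefficients ρbar f D g) {I : Set ℝ}
    (P : FluxProfile ρbar f D g c I φ v) {ϖ ℓ V₀ : ℝ}
    (hact : ∀ᶠ t in 𝓝[<] ϖ, t ∈ activeSet ρbar I φ) (hℓ : ℓ ∈ Ioo 0 ρbar)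
    (hφ : Tendsto φ (𝓝[<] ϖ) (𝓝 ℓ)) (hv : Tendsto v (𝓝[<] ϖ) (𝓝 V₀)) :
    V₀ + f ℓ - c * ℓ < 0 := by
  have hnhds : Icc 0 ρbar ∈ 𝓝 ℓ := Icc_mem_nhds hℓ.1 hℓ.2
  have hD : Tendsto (fun t => D (φ t)) (𝓝[<] ϖ) (𝓝 (D ℓ)) :=
    (H.diff.continuousAt hnhds).tendsto.comp hφ
  have hDφ' : Tendsto (fun t => D (φ t) * deriv φ t) (𝓝[<] ϖ) (𝓝 (V₀ + f ℓ - c * ℓ)) := by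
    refine (tendsto_add_flux_sub (H.flux.continuousOn.continuousAt hnhds) hφ hv).congr' ?_
    filter_upwards [hact] with t ht using (P.diff_mul_deriv_eq ht rfl).symm
  have hneg : ∀ᶠ t in 𝓝[<] ϖ, D (φ t) * deriv φ t ≤ 0 := hact.mono fun t ht =>
    mul_nonpos_of_nonneg_of_nonpos (H.diff_pos _ ht.2).le (P.deriv_neg H ht).le
  by_contra! hnonneg
  have hzero : V₀ + f ℓ - c * ℓ = 0 := hnonneg.antisymm' (le_of_tendsto hDφ' hneg)
  have hφ' : Tendsto (deriv φ) (𝓝[<] ϖ) (𝓝 0) := by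
    have hquot := hDφ'.div hD (H.diff_pos ℓ hℓ).ne'
    rw [hzero, zero_div] at hquot
    refine hquot.congr' ?_
    filter_upwards [hact] with t ht using mul_div_cancel_left₀ _ (H.diff_pos _ ht.2).ne'
  have hh : Tendsto (fun t => h ρbar f (φ t)) (𝓝[<] ϖ) (𝓝 (h ρbar f ℓ)) :=
    ((H.flux.continuousOn_derivWithin (uniqueDiffOn_Icc H.pos) le_rfl).continuousAt
      hnhds).tendsto.comp hφ
  have hderiv :=
    (((hh.const_sub c).mul hφ').add ((H.source.continuousAt hnhds).tendsto.comp hφ)).neg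
  refine hnonneg.not_gt (neg_of_tendsto_deriv_neg ?_ hneg hDφ' hderiv ?_)
  · exact hact.mono fun t ht => P.hasDerivAt_diff_mul_deriv H.flux ht
  · rw [mul_zero, zero_add]
    exact neg_neg_of_pos (H.source_pos ℓ hℓ)


theorem extend (H : Coefficients ρbar f D g) {ϖ ϖ' : ℝ}
    (P : FluxProfile ρbar f D g c (Iio ϖ) φ v) (hφ : EqOn ψ φ (Iio ϖ)) (hv : EqOn w v (Iio ϖ))
    (hsys : ∀ t ∈ Ico ϖ ϖ', SolvesSystemAt ρbar f D g c ψ w t) :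
    FluxProfile ρbar f D g c (Iio ϖ') ψ w := by
  have hψ : ∀ t < ϖ, ψ =ᶠ[𝓝 t] φ := fun t ht => eventually_of_mem (Iio_mem_nhds ht) hφ
  have hw : ∀ t < ϖ, w =ᶠ[𝓝 t] v := fun t ht => eventually_of_mem (Iio_mem_nhds ht) hv
  refine ⟨isOpen_Iio, isLowerSet_Iio ϖ', nonempty_Iio, fun t ht => ?_, fun t ht => ?_,
    fun t ht => ?_, fun t ht hmem => ?_, fun t ht hd => ?_, ?_⟩
  · rcases lt_or_ge t ϖ with hlt | hge
    · exact hφ hlt ▸ P.mapsTo hlt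
    · exact Ioo_subset_Icc_self (hsys t ⟨hge, ht⟩).mem
  · rcases lt_or_ge t ϖ with hlt | hge
    · exact ((P.continuousOn.continuousAt (Iio_mem_nhds hlt)).congr
        (hψ t hlt).symm).continuousWithinAt
    · exact (hsys t ⟨hge, ht⟩).hasDerivAt.continuousAt.continuousWithinAt
  · rcases lt_or_ge t ϖ with hlt | hge
    · rw [hφ hlt]
      exact (P.hasDerivAt_flux t hlt).congr_of_eventuallyEq (hw t hlt)
    · exact (hsys t ⟨hge, ht⟩).hasDerivAt_flux
  · rcases lt_or_ge t ϖ with hlt | hge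
    · exact (P.differentiableAt t hlt (hφ hlt ▸ hmem)).congr_of_eventuallyEq (hψ t hlt)
    · exact (hsys t ⟨hge, ht⟩).hasDerivAt.differentiableAt
  · rcases lt_or_ge t ϖ with hlt | hge
    · rw [hφ hlt, hv hlt, (hψ t hlt).deriv_eq]
      exact P.flux_eq t hlt (hd.congr_of_eventuallyEq (hψ t hlt).symm)
    · rw [(hsys t ⟨hge, ht⟩).hasDerivAt.deriv,
        mul_div_cancel₀ _ (H.diff_pos _ (hsys t ⟨hge, ht⟩).mem).ne']
  · refine P.tendsto.congr' ?_
    filter_upwards [eventually_lt_atBot ϖ] with t ht using (hφ ht).symm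

theorem exists_tendsto_of_le (H : Coefficients ρbar f D g) {ϖ p ρ₀ : ℝ}
    (P : FluxProfile ρbar f D g c (Iio ϖ) φ v) (hp : p < ϖ) (hφp : φ p < ρbar)
    (hρ₀ : 0 < ρ₀) (hlow : ∀ t < ϖ, ρ₀ ≤ φ t) :
    (∀ᶠ t in 𝓝[<] ϖ, t ∈ activeSet ρbar (Iio ϖ) φ) ∧
      ∃ ℓ ∈ Ioo 0 ρbar, Tendsto φ (𝓝[<] ϖ) (𝓝 ℓ) := by
  have hev : ∀ᶠ t in 𝓝[<] ϖ, t < ϖ ∧ φ t ∈ Icc ρ₀ (φ p) := by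
    filter_upwards [Ico_mem_nhdsLT hp] with t ht
    exact ⟨ht.2, hlow t ht.2, P.antitoneOn H hp ht.2 ht.1⟩
  have hsub : Icc ρ₀ (φ p) ⊆ Ioo 0 ρbar := fun ρ hρ => ⟨hρ₀.trans_le hρ.1, hρ.2.trans_lt hφp⟩
  have hlim := (P.antitoneOn H).tendsto_nhdsLT
    ⟨ρ₀, by rintro _ ⟨t, ht, rfl⟩; exact hlow t ht⟩
  exact ⟨hev.mono fun t ht => ⟨ht.1, hsub ht.2⟩, _,
    hsub (isClosed_Icc.mem_of_tendsto hlim (hev.mono fun t ht => ht.2)), hlim⟩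

theorem exists_extension (H : Coefficients ρbar f D g) {ϖ p ρ₀ : ℝ}
    (P : FluxProfile ρbar f D g c (Iio ϖ) φ v) (hp : p < ϖ) (hφp : φ p < ρbar)
    (hρ₀ : 0 < ρ₀) (hlow : ∀ t < ϖ, ρ₀ ≤ φ t) :
    ∃ ϖ' > ϖ, ∃ φ' v' : ℝ → ℝ, FluxProfile ρbar f D g c (Iio ϖ') φ' v' ∧
      EqOn φ' φ (Iio ϖ) ∧ MapsTo φ' (Ico ϖ ϖ') (Ioo 0 ρbar) := by
  obtain ⟨hact, ℓ, hℓ, hφℓ⟩ := P.exists_tendsto_of_le H hp hφp hρ₀ hlow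
  obtain ⟨V₀, hV₀⟩ := P.exists_tendsto_flux H
  obtain ⟨ψ, w, rfl, rfl, hψ⟩ := exists_eventually_solvesSystemAt H hℓ
    (P.add_flux_sub_neg_of_tendsto H hact hℓ hφℓ hV₀) ϖ
  obtain ⟨ε, hε, hball⟩ := Metric.eventually_nhds_iff_ball.1 hψ
  rw [Real.ball_eq_Ioo] at hball
  have hsys : ∀ t ∈ Ico ϖ (ϖ + ε), SolvesSystemAt ρbar f D g c
      (fun t => if t < ϖ then φ t else ψ t) (fun t => if t < ϖ then v t else w t) t := by
    intro t ht
    rcases ht.1.eq_or_lt with rfl | hlt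
    · exact .ite H (hact.mono fun t ht => P.solvesSystemAt H ht) hψ.self_of_nhds hφℓ hV₀
    · refine (hball t ⟨by linarith, ht.2⟩).congr ?_ ?_ <;>
        filter_upwards [Ioi_mem_nhds hlt] with s hs using if_neg (not_lt_of_gt hs)
  exact ⟨ϖ + ε, lt_add_of_pos_right ϖ hε, _, _,
    P.extend H (fun t ht => if_pos ht) (fun t ht => if_pos ht) hsys, fun t ht => if_pos ht,
    fun t ht => (hsys t ht).mem⟩

end FluxProfile

/-! ### Maximal profiles -/

variable {I U V : Set ℝ}

theorem IsClassicalOn.congr (hU : IsOpen U) (hφ : IsClassicalOn ρbar f D g c U φ)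
    (heq : EqOn ψ φ U) : IsClassicalOn ρbar f D g c U ψ := by
  have hψ : ∀ t ∈ U, ψ =ᶠ[𝓝 t] φ := fun t ht => heq.eventuallyEq_of_mem (hU.mem_nhds ht)
  have hDψ : EqOn (fun t => D (ψ t) * deriv ψ t) (fun t => D (φ t) * deriv φ t) U := fun t ht => by
    simp only [heq ht, (hψ t ht).deriv_eq]
  refine ⟨fun t ht => (hφ.differentiableAt t ht).congr_of_eventuallyEq (hψ t ht),
    fun a b hab hsub => absolutelyContinuousOnInterval_congr ?_
      (hφ.absolutelyContinuous a b hab hsub), ?_⟩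
  · rw [uIcc_of_le hab]
    exact hDψ.symm.mono hsub
  · filter_upwards [hφ.equation, ae_restrict_mem hU.measurableSet] with t ht htU
    rw [heq htU, (hψ t htU).deriv_eq]
    exact ht.congr_of_eventuallyEq (hDψ.eventuallyEq_of_mem (hU.mem_nhds htU))

theorem IsClassicalOn.union (hU : IsOpen U) (hV : IsOpen V)
    (hφU : IsClassicalOn ρbar f D g c U φ) (hφV : IsClassicalOn ρbar f D g c V φ) :
    IsClassicalOn ρbar f D g c (U ∪ V) φ :=
  ⟨fun t ht => ht.elim (hφU.differentiableAt t) (hφV.differentiableAt t),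
    fun _ _ hab hsub => absolutelyContinuousOnInterval_of_subset_union hU hV
      hφU.absolutelyContinuous hφV.absolutelyContinuous hab hsub,
    (ae_restrict_union_iff _ _ _).2 ⟨hφU.equation, hφV.equation⟩⟩

namespace FluxProfile

theorem isClassicalOn_activeSet (H : Coefficients ρbar f D g)
    (P : FluxProfile ρbar f D g c I φ v) :
    IsClassicalOn ρbar f D g c (activeSet ρbar I φ) φ := by
  have hv : ContDiffOn ℝ 1 v (activeSet ρbar I φ) := by
    rw [← zero_add (1 : WithTop ℕ∞), contDiffOn_succ_iff_deriv_of_isOpen P.isOpen_activeSet]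
    refine ⟨fun t ht => (P.hasDerivAt_flux t ht.1).differentiableAt.differentiableWithinAt,
      by simp, contDiffOn_zero.2 ?_⟩
    exact ((H.source.comp P.continuousOn P.mapsTo).mono inter_subset_left).neg.congr
      fun t ht => (P.hasDerivAt_flux t ht.1).deriv
  have hflux : ContDiffOn ℝ 1 (fun t => D (φ t) * deriv φ t) (activeSet ρbar I φ) :=
    ((hv.add (H.flux.comp (P.contDiffOn H) fun t ht => P.mapsTo ht.1)).sub
      (contDiffOn_const.mul (P.contDiffOn H))).congr fun t ht => P.diff_mul_deriv_eq ht rfl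
  refine ⟨fun t ht => P.differentiableAt t ht.1 ht.2, fun a b hab hsub =>
    ContDiffOn.absolutelyContinuousOnInterval (hflux.mono (uIcc_of_le hab ▸ hsub)), ?_⟩
  filter_upwards [ae_restrict_mem P.isOpen_activeSet.measurableSet] with t ht
  exact P.hasDerivAt_diff_mul_deriv H.flux ht

theorem isTravelingWave (H : Coefficients ρbar f D g) (P : FluxProfile ρbar f D g c I φ v)
    (hd : ∀ᵐ ξ ∂(volume.restrict I), DifferentiableAt ℝ φ ξ) :
    IsTravelingWave ρbar f D g c I φ := by
  have hI := P.isOpen.measurableSet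
  have hv : ContinuousOn v I := fun ξ hξ =>
    (P.hasDerivAt_flux ξ hξ).continuousAt.continuousWithinAt
  have hflux : ∀ᵐ ξ ∂(volume.restrict I),
      D (φ ξ) * deriv φ ξ = v ξ + f (φ ξ) - c * φ ξ := by
    filter_upwards [hd, ae_restrict_mem hI] with ξ hξ hξI using P.flux_eq ξ hξI hξ
  have hloc : LocallyIntegrableOn (fun ξ => v ξ + f (φ ξ) - c * φ ξ) I :=
    ((hv.add (H.flux.continuousOn.comp P.continuousOn P.mapsTo)).sub
      (continuousOn_const.mul P.continuousOn)).locallyIntegrableOn hI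
  refine ⟨P.isOpen, P.isLowerSet.ordConnected, P.mapsTo, P.continuousOn, hd, fun ξ hξ => ?_,
    fun ψ ψs ψc ψI => ?_⟩
  · obtain ⟨s, hs, hint⟩ := hloc ξ hξ
    refine ⟨s ∩ I, inter_mem hs self_mem_nhdsWithin,
      (hint.mono_set inter_subset_left).congr_fun_ae ?_⟩
    filter_upwards [ae_restrict_of_ae_restrict_of_subset inter_subset_right hflux] with t ht
      using ht.symm
  · have hg : LocallyIntegrableOn (fun ξ => g (φ ξ)) I :=
      (H.source.comp P.continuousOn P.mapsTo).locallyIntegrableOn hI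
    calc
      _ = ∫ ξ in I, (v ξ * deriv ψ ξ - g (φ ξ) * ψ ξ) := integral_congr_ae <| by
          filter_upwards [hflux] with ξ hξ
          rw [hξ]
          ring
      _ = 0 := by
          rw [integral_sub
            (integrableOn_mul_of_tsupport_subset hI (hv.locallyIntegrableOn hI)
              (ψs.continuous_deriv (by simp)) ψc.deriv (tsupport_deriv_subset.trans ψI))
            (integrableOn_mul_of_tsupport_subset hI hg ψs.continuous ψc ψI),
            integral_mul_deriv_eq_neg_integral_mul hI P.hasDerivAt_flux hg.neg ψs ψc ψI]
          simp only [neg_mul, integral_neg, neg_neg, sub_self]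

theorem surjOn (P : FluxProfile ρbar f D g c I φ v)
    (hlow : ∀ ρ ∈ Ioo 0 ρbar, ∃ b ∈ I, φ b < ρ) : SurjOn φ I (Ioo 0 ρbar) := by
  intro ρ hρ
  obtain ⟨b, hb, hbρ⟩ := hlow ρ hρ
  obtain ⟨a, hρa, hab⟩ := ((P.tendsto.eventually_const_lt hρ.2).and (eventually_le_atBot b)).exists
  exact P.isLowerSet.ordConnected.isPreconnected.intermediate_value hb (P.isLowerSet hab hb)
    P.continuousOn ⟨hbρ.le, hρa.le⟩

end FluxProfile

theorem IsSemiWavefrontFrom.of_extension (H : Coefficients ρbar f D g) {ϖ ϖ' : ℝ}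
    (hφ : IsSemiWavefrontFrom ρbar f D g c ρbar ϖ φ) (hϖ : ϖ ≤ ϖ')
    (P : FluxProfile ρbar f D g c (Iio ϖ') ψ w) (heq : EqOn ψ φ (Iio ϖ))
    (hmaps : MapsTo ψ (Ico ϖ ϖ') (Ioo 0 ρbar)) :
    IsSemiWavefrontFrom ρbar f D g c ρbar ϖ' ψ := by
  obtain ⟨S, hSfin, hSϖ, hsharp, hclassical⟩ := hφ.classicalOrSharp
  have hψ : ∀ t < ϖ, ψ =ᶠ[𝓝 t] φ := fun t ht => eventually_of_mem (Iio_mem_nhds ht) heq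
  have hSψ : ∀ ξ ∈ S, g (ψ ξ) = 0 ∧ ¬ DifferentiableAt ℝ ψ ξ := fun ξ hξ => by
    rw [(hψ ξ (hSϖ hξ)).differentiableAt_iff, heq (hSϖ hξ)]
    exact hsharp ξ hξ
  have hopen : IsOpen (Iio ϖ \ S) := isOpen_Iio.sdiff hSfin.isClosed
  have hcover : Iio ϖ' \ S = Iio ϖ \ S ∪ activeSet ρbar (Iio ϖ') ψ := by
    refine Subset.antisymm (fun t ht => ?_) (union_subset
      (sdiff_subset_sdiff_left (Iio_subset_Iio hϖ))
      fun t ht => ⟨ht.1, fun hS => (H.source_pos _ ht.2).ne' (hSψ t hS).1⟩)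
    exact (lt_or_ge t ϖ).imp (fun hlt => ⟨hlt, ht.2⟩) fun hge => ⟨ht.1, hmaps ⟨hge, ht.1⟩⟩
  have hψ_classical : IsClassicalOn ρbar f D g c (Iio ϖ' \ S) ψ := hcover ▸
    (hclassical.congr hopen (heq.mono sdiff_subset)).union hopen P.isOpen_activeSet
      (P.isClassicalOn_activeSet H)
  have hd : ∀ᵐ ξ ∂(volume.restrict (Iio ϖ')), DifferentiableAt ℝ ψ ξ := by
    filter_upwards [ae_restrict_mem measurableSet_Iio,
      ae_restrict_of_ae (hSfin.countable.ae_notMem volume)] with ξ hξ hξS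
    exact hψ_classical.differentiableAt ξ ⟨hξ, hξS⟩
  obtain ⟨a, ha, b, hb, hne⟩ := hφ.nonconstant
  exact ⟨P.isTravelingWave H hd,
    ⟨S, hSfin, hSϖ.trans (Iio_subset_Iio hϖ), hSψ, hψ_classical⟩, hφ.mem, hφ.source_eq_zero,
    Or.inr (P.antitoneOn H), ⟨a, Iio_subset_Iio hϖ ha, b, Iio_subset_Iio hϖ hb,
      by rwa [heq ha, heq hb]⟩, P.tendsto⟩

theorem IsMaximalSemiWavefrontFrom.exists_fluxProfile (H : Coefficients ρbar f D g) {ϖ p : ℝ}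
    (hφ : IsMaximalSemiWavefrontFrom ρbar f D g c ρbar ϖ φ) (hp : p < ϖ) (hφp : φ p < ρbar) :
    ∃ v, FluxProfile ρbar f D g c (Iio ϖ) φ v ∧ SurjOn φ (Iio ϖ) (Ioo 0 ρbar) := by
  obtain ⟨v, P⟩ := hφ.1.travelingWave.exists_fluxProfile H hφ.1.classicalOrSharp
    (isLowerSet_Iio ϖ) nonempty_Iio hφ.1.tendsto
  refine ⟨v, P, P.surjOn fun ρ hρ => ?_⟩
  by_contra! hlow
  obtain ⟨ϖ', hϖ', φ', v', P', heq, hmaps⟩ := P.exists_extension H hp hφp hρ.1 hlow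
  exact hφ.2 ϖ' hϖ' ⟨φ', hφ.1.of_extension H (le_of_lt hϖ') P' heq hmaps, heq⟩

theorem IsWavefront.exists_fluxProfile (H : Coefficients ρbar f D g)
    (hφ : IsWavefront ρbar f D g c ρbar 0 φ) :
    ∃ v, FluxProfile ρbar f D g c univ φ v ∧ SurjOn φ univ (Ioo 0 ρbar) := by
  obtain ⟨v, P⟩ := hφ.travelingWave.exists_fluxProfile H hφ.classicalOrSharp isLowerSet_univ
    univ_nonempty hφ.tendsto_atBot
  refine ⟨v, P, P.surjOn fun ρ hρ => ?_⟩
  obtain ⟨b, hb⟩ := (hφ.tendsto_atTop.eventually_lt_const hρ.1).exists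
  exact ⟨b, mem_univ b, hb⟩

/-! ### Comparison in the phase plane -/

namespace PhaseTrajectory

section

variable {ρbar : ℝ} {f D g g₁ g₂ : ℝ → ℝ} {c : ℝ} {y Z y₁ Z₁ y₂ Z₂ : ℝ → ℝ}

theorem continuousOn (hf : ContinuousOn f (Icc 0 ρbar)) (T : PhaseTrajectory ρbar f D g c y Z) :
    ContinuousOn Z (Ioo 0 ρbar) := by
  have hZ : ContinuousOn (fun r => Z r - f r + c * r) (Ioo 0 ρbar) := fun x hx =>
    (T.hasDerivAt x hx).continuousAt.continuousWithinAt
  refine ((hZ.add (hf.mono Ioo_subset_Icc_self)).sub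
    (continuousOn_const.mul continuousOn_id)).congr (f := fun r => _ + f r - c * r) fun x _ => ?_
  ring

theorem strictAntiOn_inverse (hD : ∀ ρ ∈ Ioo 0 ρbar, 0 < D ρ)
    (T : PhaseTrajectory ρbar f D g c y Z) : StrictAntiOn y (Ioo 0 ρbar) := by
  refine strictAntiOn_of_deriv_neg (convex_Ioo 0 ρbar)
    (fun x hx => (T.hasDerivAt_inverse x hx).continuousAt.continuousWithinAt) fun x hx => ?_
  rw [interior_Ioo] at hx
  rw [(T.hasDerivAt_inverse x hx).deriv]
  exact div_neg_of_pos_of_neg (hD x hx) (T.neg x hx)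

theorem hasDerivAt_sub (T₁ : PhaseTrajectory ρbar f D g₁ c y₁ Z₁)
    (T₂ : PhaseTrajectory ρbar f D g₂ c y₂ Z₂) {ρ : ℝ} (hρ : ρ ∈ Ioo 0 ρbar) :
    HasDerivAt (fun r => Z₁ r - Z₂ r) (D ρ * (g₁ ρ / -Z₁ ρ - g₂ ρ / -Z₂ ρ)) ρ :=
  (((T₁.hasDerivAt ρ hρ).sub (T₂.hasDerivAt ρ hρ)).congr_deriv (by ring)).congr_of_eventuallyEq
    (Eventually.of_forall fun r => by simp only [Pi.sub_apply]; ring)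

theorem le_of_source_le (hD : ∀ ρ ∈ Ioo 0 ρbar, 0 < D ρ) (hg₂ : ∀ ρ ∈ Ioo 0 ρbar, 0 < g₂ ρ)
    (hg : ∀ ρ ∈ Ioo 0 ρbar, g₂ ρ ≤ g₁ ρ) (T₁ : PhaseTrajectory ρbar f D g₁ c y₁ Z₁)
    (T₂ : PhaseTrajectory ρbar f D g₂ c y₂ Z₂) {ρ : ℝ} (hρ : ρ ∈ Ioo 0 ρbar) : Z₁ ρ ≤ Z₂ ρ := by
  refine sub_nonpos.1 (nonpos_of_tendsto_zero_of_deriv_pos (u := fun r => Z₁ r - Z₂ r)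
    (fun x hx => T₁.hasDerivAt_sub T₂ hx) (fun x hx hlt => mul_pos (hD x hx) (sub_pos.2 ?_))
    (by simpa only [sub_zero] using T₁.tendsto.sub T₂.tendsto) hρ)
  have hZ₁ : 0 < -Z₁ x := neg_pos.2 (T₁.neg x hx)
  calc g₂ x / -Z₂ x < g₂ x / -Z₁ x :=
        div_lt_div_of_pos_left (hg₂ x hx) hZ₁ (neg_lt_neg (sub_pos.1 hlt))
    _ ≤ g₁ x / -Z₁ x := div_le_div_of_nonneg_right (hg x hx) hZ₁.le

/-- The function `Z₂ - Z₁ - ε y₂` is nondecreasing, because `Z₁ ≤ Z₂` and `g₁ ≤ g₂ + ε`. -/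
theorem sub_le_of_source_le {ε ρ r : ℝ} (hD : ∀ ρ ∈ Ioo 0 ρbar, 0 < D ρ)
    (hg₂ : ∀ ρ ∈ Ioo 0 ρbar, 0 < g₂ ρ) (hg : ∀ ρ ∈ Ioo 0 ρbar, g₂ ρ ≤ g₁ ρ)
    (hε : ∀ ρ ∈ Ioo 0 ρbar, g₁ ρ ≤ g₂ ρ + ε) (T₁ : PhaseTrajectory ρbar f D g₁ c y₁ Z₁)
    (T₂ : PhaseTrajectory ρbar f D g₂ c y₂ Z₂) (hρ : ρ ∈ Ioo 0 ρbar) (hr : r ∈ Ioo 0 ρbar)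
    (hρr : ρ ≤ r) : Z₂ ρ - Z₁ ρ ≤ Z₂ r - Z₁ r + ε * (y₂ ρ - y₂ r) := by
  have hderiv : ∀ x ∈ Ioo 0 ρbar, HasDerivAt (fun x => Z₂ x - Z₁ x - ε * y₂ x)
      (D x * ((g₂ x + ε) / -Z₂ x - g₁ x / -Z₁ x)) x := fun x hx =>
    ((T₂.hasDerivAt_sub T₁ hx).fun_sub ((T₂.hasDerivAt_inverse x hx).const_mul ε)).congr_deriv
      (by ring)
  have hquot : ∀ x ∈ Ioo 0 ρbar, g₁ x / -Z₁ x ≤ (g₂ x + ε) / -Z₂ x := fun x hx => by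
    have hZ₂ : 0 < -Z₂ x := neg_pos.2 (T₂.neg x hx)
    calc g₁ x / -Z₁ x ≤ g₁ x / -Z₂ x := div_le_div_of_nonneg_left ((hg₂ x hx).le.trans (hg x hx))
          hZ₂ (neg_le_neg (le_of_source_le hD hg₂ hg T₁ T₂ hx))
      _ ≤ (g₂ x + ε) / -Z₂ x := div_le_div_of_nonneg_right (hε x hx) hZ₂.le
  have hmono : MonotoneOn (fun x => Z₂ x - Z₁ x - ε * y₂ x) (Ioo 0 ρbar) := by
    refine monotoneOn_of_deriv_nonneg (convex_Ioo 0 ρbar)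
      (fun x hx => (hderiv x hx).continuousAt.continuousWithinAt)
      (fun x hx => (hderiv x (interior_subset hx)).differentiableAt.differentiableWithinAt)
      fun x hx => ?_
    rw [interior_Ioo] at hx
    rw [(hderiv x hx).deriv]
    exact mul_nonneg (hD x hx).le (sub_nonneg.2 (hquot x hx))
  linarith [hmono hρ hr hρr]

end

variable {ρbar : ℝ} {f D g₀ : ℝ → ℝ} {c : ℝ} {g : ℕ → ℝ → ℝ} {y₀ Z₀ : ℝ → ℝ} {y Z : ℕ → ℝ → ℝ}

/-- The two comparison estimates squeeze `Z n`: near `ρbar` the trajectories lie between `Z 0` and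
`0`, and away from `ρbar` their distance to `Z₀` is controlled by that of `g n` to `g₀`. -/
theorem tendstoLocallyUniformlyOn (hD : ∀ ρ ∈ Ioo 0 ρbar, 0 < D ρ)
    (hg₀ : ∀ ρ ∈ Ioo 0 ρbar, 0 < g₀ ρ) (hge : ∀ n, ∀ ρ ∈ Ioo 0 ρbar, g₀ ρ ≤ g n ρ)
    (hle : ∀ n, ∀ ρ ∈ Ioo 0 ρbar, g n ρ ≤ g 0 ρ) (hlim : TendstoUniformlyOn g g₀ atTop (Ioo 0 ρbar))
    (T₀ : PhaseTrajectory ρbar f D g₀ c y₀ Z₀)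
    (T : ∀ n, PhaseTrajectory ρbar f D (g n) c (y n) (Z n)) :
    TendstoLocallyUniformlyOn Z Z₀ atTop (Ioo 0 ρbar) := by
  rw [Metric.tendstoUniformlyOn_iff] at hlim
  rw [Metric.tendstoLocallyUniformlyOn_iff]
  intro ε hε x hx
  obtain ⟨a, ha, hax⟩ := exists_between hx.1
  obtain ⟨r, hZr, hxr, hr⟩ := (((T 0).tendsto.eventually_const_lt
    (neg_lt_zero.2 (half_pos hε))).and (Ioo_mem_nhdsLT hx.2)).exists
  have haI : a ∈ Ioo 0 ρbar := ⟨ha, hax.trans hx.2⟩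
  have hrI : r ∈ Ioo 0 ρbar := ⟨hx.1.trans hxr, hr⟩
  obtain ⟨δ, hδ, hδε⟩ := exists_pos_mul_lt (half_pos hε) (y₀ a - y₀ r)
  refine ⟨Ioo a r, mem_nhdsWithin_of_mem_nhds (Ioo_mem_nhds hax hxr), ?_⟩
  filter_upwards [hlim δ hδ] with n hn ρ hρ
  have hρI : ρ ∈ Ioo 0 ρbar := ⟨ha.trans hρ.1, hρ.2.trans hr⟩
  have hnδ : ∀ ρ ∈ Ioo 0 ρbar, g n ρ ≤ g₀ ρ + δ := fun ρ hρ => by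
    linarith [(abs_lt.1 (Real.dist_eq _ _ ▸ hn ρ hρ)).1]
  have hZr_le : Z₀ r - Z n r < ε / 2 := by
    linarith [T₀.neg r hrI,
      le_of_source_le hD (fun ρ hρ => (hg₀ ρ hρ).trans_le (hge n ρ hρ)) (hle n)
      (T 0) (T n) hrI]
  have hy_le : δ * (y₀ ρ - y₀ r) ≤ (y₀ a - y₀ r) * δ := by
    rw [mul_comm]
    gcongr
    exact (T₀.strictAntiOn_inverse hD haI hρI hρ.1).le
  rw [Real.dist_eq, abs_of_nonneg (sub_nonneg.2 (le_of_source_le hD hg₀ (hge n) (T n) T₀ hρI))]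
  linarith [sub_le_of_source_le hD hg₀ (hge n) hnδ (T n) T₀ hρI hrI hρ.2.le]

theorem tendstoLocallyUniformlyOn_inverse (hf : ContinuousOn f (Icc 0 ρbar))
    (hD : ContinuousOn D (Icc 0 ρbar)) (T₀ : PhaseTrajectory ρbar f D g₀ c y₀ Z₀)
    (T : ∀ n, PhaseTrajectory ρbar f D (g n) c (y n) (Z n))
    (hZ : TendstoLocallyUniformlyOn Z Z₀ atTop (Ioo 0 ρbar)) {p : ℝ} (hp : p ∈ Ioo 0 ρbar)
    (hyp : ∀ n, y n p = y₀ p) : TendstoLocallyUniformlyOn y y₀ atTop (Ioo 0 ρbar) := by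
  have hquot : TendstoLocallyUniformlyOn (fun n ρ => D ρ / Z n ρ) (fun ρ => D ρ / Z₀ ρ) atTop
      (Ioo 0 ρbar) :=
    TendstoLocallyUniformlyOn.div₀ (tendstoLocallyUniformlyOn_const D) hZ
      (hD.mono Ioo_subset_Icc_self) (T₀.continuousOn hf) fun ρ hρ => (T₀.neg ρ hρ).ne
  exact tendstoLocallyUniformlyOn_of_tendstoLocallyUniformlyOn_deriv isOpen_Ioo ordConnected_Ioo
    hp (fun n => (T n).hasDerivAt_inverse) T₀.hasDerivAt_inverse hyp hquot

end PhaseTrajectory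

/-! ### Convergence of profiles -/

theorem TendstoC1Loc.mono {I : ℕ → Set ℝ} {φ : ℕ → ℝ → ℝ} {φ₀ : ℝ → ℝ} {J J' : Set ℝ}
    (h : TendstoC1Loc I φ φ₀ J) (hJ : J' ⊆ J) : TendstoC1Loc I φ φ₀ J' :=
  ⟨h.1.mono hJ, fun K hK hKJ => h.2 K hK (hKJ.trans hJ)⟩

namespace FluxProfile

section

variable {ρbar : ℝ} {f D g : ℝ → ℝ} {c : ℝ} {I : Set ℝ} {φ v y : ℝ → ℝ}

theorem subset_and_mapsTo_Icc (H : Coefficients ρbar f D g) (P : FluxProfile ρbar f D g c I φ v)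
    (hsurj : SurjOn φ I (Ioo 0 ρbar)) (hy : LeftInvOn y φ (activeSet ρbar I φ)) {a b α β : ℝ}
    (ha : a ∈ Ioo 0 ρbar) (hb : b ∈ Ioo 0 ρbar) (hα : y b ≤ α) (hβ : β ≤ y a) :
    Icc α β ⊆ I ∧ MapsTo φ (Icc α β) (Icc a b) := by
  obtain ⟨xa, hxa, rfl⟩ := hsurj ha
  obtain ⟨xb, hxb, rfl⟩ := hsurj hb
  rw [hy ⟨hxb, hb⟩] at hα
  rw [hy ⟨hxa, ha⟩] at hβ
  have hI : ∀ x ∈ Icc α β, x ∈ I := fun x hx => P.isLowerSet (hx.2.trans hβ) hxa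
  exact ⟨hI, fun x hx => ⟨P.antitoneOn H (hI x hx) hxa (hx.2.trans hβ),
    P.antitoneOn H hxb (hI x hx) (hα.trans hx.1)⟩⟩

end

variable {ρbar : ℝ} {f D g₀ : ℝ → ℝ} {g : ℕ → ℝ → ℝ} {c : ℝ} {I₀ : Set ℝ} {I : ℕ → Set ℝ}
  {φ₀ v₀ y₀ : ℝ → ℝ} {φ v y : ℕ → ℝ → ℝ}

theorem exists_Icc_eventually_mapsTo (H₀ : Coefficients ρbar f D g₀)
    (H : ∀ n, Coefficients ρbar f D (g n)) (P₀ : FluxProfile ρbar f D g₀ c I₀ φ₀ v₀)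
    (hsurj₀ : SurjOn φ₀ I₀ (Ioo 0 ρbar)) (P : ∀ n, FluxProfile ρbar f D (g n) c (I n) (φ n) (v n))
    (hsurj : ∀ n, SurjOn (φ n) (I n) (Ioo 0 ρbar)) (hy₀ : LeftInvOn y₀ φ₀ (activeSet ρbar I₀ φ₀))
    (hy₀_anti : StrictAntiOn y₀ (Ioo 0 ρbar))
    (hy : ∀ n, LeftInvOn (y n) (φ n) (activeSet ρbar (I n) (φ n)))
    (hlim : ∀ ρ ∈ Ioo 0 ρbar, Tendsto (fun n => y n ρ) atTop (𝓝 (y₀ ρ))) {K : Set ℝ}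
    (hK : IsCompact K) (hKA : K ⊆ activeSet ρbar I₀ φ₀) :
    ∃ a b, Icc a b ⊆ Ioo 0 ρbar ∧ MapsTo φ₀ K (Icc a b) ∧
      ∀ᶠ n in atTop, K ⊆ I n ∧ MapsTo (φ n) K (Icc a b) := by
  rcases K.eq_empty_or_nonempty with rfl | hne
  · exact ⟨1, 0, by simp, mapsTo_empty _ _, by simp⟩
  have hα := hKA (hK.sInf_mem hne)
  have hβ := hKA (hK.sSup_mem hne)
  have hK_sub : K ⊆ Icc (sInf K) (sSup K) := subset_Icc_csInf_csSup hK.bddBelow hK.bddAbove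
  obtain ⟨a, ha, haβ⟩ := exists_between hβ.2.1
  obtain ⟨b, hαb, hb⟩ := exists_between hα.2.2
  have haI : a ∈ Ioo 0 ρbar := ⟨ha, haβ.trans hβ.2.2⟩
  have hbI : b ∈ Ioo 0 ρbar := ⟨hα.2.1.trans hαb, hb⟩
  have hyb : y₀ b < sInf K := (hy₀_anti hα.2 hbI hαb).trans_eq (hy₀ hα)
  have hya : sSup K < y₀ a := (hy₀ hβ).symm.trans_lt (hy₀_anti haI hβ.2 haβ)
  refine ⟨a, b, Icc_subset_Ioo ha hb,
    (P₀.subset_and_mapsTo_Icc H₀ hsurj₀ hy₀ haI hbI hyb.le hya.le).2.mono_left hK_sub, ?_⟩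
  filter_upwards [(hlim b hbI).eventually_lt_const hyb, (hlim a haI).eventually_const_lt hya]
    with n hbn han
  obtain ⟨hI, hmaps⟩ := (P n).subset_and_mapsTo_Icc (H n) (hsurj n) (hy n) haI hbI hbn.le han.le
  exact ⟨hK_sub.trans hI, hmaps.mono_left hK_sub⟩

theorem tendstoC1Loc (H₀ : Coefficients ρbar f D g₀) (H : ∀ n, Coefficients ρbar f D (g n))
    (hge : ∀ n, ∀ ρ ∈ Ioo 0 ρbar, g₀ ρ ≤ g n ρ) (hle : ∀ n, ∀ ρ ∈ Ioo 0 ρbar, g n ρ ≤ g 0 ρ)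
    (hlim : TendstoUniformlyOn g g₀ atTop (Ioo 0 ρbar))
    (P₀ : FluxProfile ρbar f D g₀ c I₀ φ₀ v₀) (hsurj₀ : SurjOn φ₀ I₀ (Ioo 0 ρbar))
    (P : ∀ n, FluxProfile ρbar f D (g n) c (I n) (φ n) (v n))
    (hsurj : ∀ n, SurjOn (φ n) (I n) (Ioo 0 ρbar)) {t : ℝ} (ht₀ : t ∈ activeSet ρbar I₀ φ₀)
    (ht : ∀ n, t ∈ I n) (hφt : ∀ n, φ n t = φ₀ t) :
    TendstoC1Loc I φ φ₀ (activeSet ρbar I₀ φ₀) := by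
  obtain ⟨y₀, Z₀, T₀, hy₀, hφ₀'⟩ := P₀.exists_phaseTrajectory H₀ hsurj₀
  choose y Z T hy hφ' using fun n => (P n).exists_phaseTrajectory (H n) (hsurj n)
  have hyt : ∀ n, y n (φ₀ t) = y₀ (φ₀ t) := fun n => by
    rw [hy₀.1 ht₀, ← hφt n, (hy n).1 ⟨ht n, mem_preimage.2 (hφt n ▸ ht₀.2)⟩]
  have hZ_lim := PhaseTrajectory.tendstoLocallyUniformlyOn H₀.diff_pos H₀.source_pos hge hle hlim
    T₀ T
  have hy_lim := PhaseTrajectory.tendstoLocallyUniformlyOn_inverse H₀.flux.continuousOn H₀.diff T₀ T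
    hZ_lim ht₀.2 hyt
  have hZ₀ := T₀.continuousOn H₀.flux.continuousOn
  have hD := H₀.diff.mono Ioo_subset_Icc_self
  have hD_ne : ∀ ρ ∈ Ioo 0 ρbar, D ρ ≠ 0 := fun ρ hρ => (H₀.diff_pos ρ hρ).ne'
  have hZD_lim := hZ_lim.div₀ (tendstoLocallyUniformlyOn_const D) hZ₀ hD hD_ne
  refine ⟨P₀.contDiffOn H₀, fun K hK hKA => ?_⟩
  obtain ⟨a, b, hab, hmaps₀, hmaps⟩ := exists_Icc_eventually_mapsTo H₀ H P₀ hsurj₀ P hsurj hy₀.1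
    (T₀.strictAntiOn_inverse H₀.diff_pos) (fun n => (hy n).1) (fun ρ hρ => hy_lim.tendsto_at hρ)
    hK hKA
  have hactive : ∀ᶠ n in atTop, K ⊆ activeSet ρbar (I n) (φ n) :=
    hmaps.mono fun n hn x hx => ⟨hn.1 hx, hab (hn.2 hx)⟩
  have hIcc : ∀ {F : ℕ → ℝ → ℝ} {u : ℝ → ℝ}, TendstoLocallyUniformlyOn F u atTop (Ioo 0 ρbar) →
      TendstoUniformlyOn F u atTop (Icc a b) := fun h =>
    (tendstoLocallyUniformlyOn_iff_tendstoUniformlyOn_of_compact isCompact_Icc).1 (h.mono hab)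
  have hφ_lim : TendstoUniformlyOn φ φ₀ atTop K :=
    tendstoUniformlyOn_of_inverse hK (fun x hx => (P₀.hasDerivAt H₀ (hKA hx)).continuousAt)
      (hy₀.2.mono hab) ((hmaps.and hactive).mono fun n hn => ⟨hn.1.2, (hy n).1.mono hn.2⟩)
      (hIcc hy_lim)
  have hφ'_lim : TendstoUniformlyOn (fun n => deriv (φ n)) (deriv φ₀) atTop K :=
    ((tendstoUniformlyOn_comp (isCompact_Icc.uniformContinuousOn_of_continuous
      ((hZ₀.div hD hD_ne).mono hab)) hmaps₀ (hmaps.mono fun n hn => hn.2)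
      (hIcc hZD_lim) hφ_lim).congr
      (hactive.mono fun n hn x hx => (hφ' n (hn hx)).symm)).congr_right
      fun x hx => (hφ₀' (hKA hx)).symm
  exact ⟨hactive.mono fun n hn => ⟨activeSet ρbar (I n) (φ n), (P n).isOpen_activeSet, hn,
    inter_subset_left, (P n).contDiffOn (H n)⟩, hφ_lim, hφ'_lim⟩

end FluxProfile

end SemiWave

theorem mainTheorem4_general {ρbar : ℝ} {f D g₀ : ℝ → ℝ} {g : ℕ → ℝ → ℝ}
    (H₀ : SemiWave.Coefficients ρbar f D g₀) (H : ∀ n, SemiWave.Coefficients ρbar f D (g n))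
    (hge : ∀ n, ∀ ρ ∈ Ioo 0 ρbar, g₀ ρ ≤ g n ρ) (hle : ∀ n, ∀ ρ ∈ Ioo 0 ρbar, g n ρ ≤ g 0 ρ)
    (hlim : TendstoUniformlyOn g g₀ atTop (Ioo 0 ρbar)) {c t : ℝ} {φ₀ : ℝ → ℝ}
    (hφ₀ : SemiWave.IsWavefront ρbar f D g₀ c ρbar 0 φ₀) (ht : φ₀ t ∈ Ioo 0 ρbar)
    {ϖ : ℕ → ℝ} {φ : ℕ → ℝ → ℝ}
    (hφ : ∀ n, SemiWave.IsMaximalSemiWavefrontFrom ρbar f D (g n) c ρbar (ϖ n) (φ n))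
    (hϖ : ∀ n, t < ϖ n) (hφt : ∀ n, φ n t = φ₀ t) :
    SemiWave.TendstoC1Loc (fun n => Iio (ϖ n)) φ φ₀ (φ₀ ⁻¹' Ioo 0 ρbar) := by
  obtain ⟨v₀, P₀, hsurj₀⟩ := hφ₀.exists_fluxProfile H₀
  choose v P hsurj using fun n => (hφ n).exists_fluxProfile (H n) (hϖ n) (hφt n ▸ ht.2)
  exact (SemiWave.FluxProfile.tendstoC1Loc H₀ H hge hle hlim P₀ hsurj₀ P hsurj ⟨mem_univ t, ht⟩ hϖ
    hφt).mono fun ξ hξ => ⟨mem_univ ξ, hξ⟩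

/-- Convergence of semi-wavefront profiles to a wavefront profile (the sequence of the source terms
is indexed by `ℕ`). -/
theorem mainTheorem4
    (ρbar : ℝ) (hρbar : 0 < ρbar)
    (f D g₀ : ℝ → ℝ) (g : ℕ → ℝ → ℝ)
    (hf : ContDiffOn ℝ 1 f (Icc 0 ρbar)) (hf0 : f 0 = 0)
    (hD : SemiWave.CondDhat ρbar D ∨
      (SemiWave.CondDtilde ρbar D g₀ ∧ ∀ n, SemiWave.CondDtilde ρbar D (g n)))
    (hg₀ : SemiWave.CondG₀ ρbar D g₀)
    (hg : ∀ n, SemiWave.CondG ρbar (g n))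
    (hg_decreasing : ∀ n, ∀ ρ ∈ Icc 0 ρbar, g (n + 1) ρ ≤ g n ρ)
    (hg_tendsto : TendstoUniformlyOn g g₀ atTop (Icc 0 ρbar))
    (c : ℝ) (hc : SemiWave.thresholdSpeed ρbar f D g₀ ≤ (c : EReal))
    (φ₀ : ℝ → ℝ) (hφ₀ : SemiWave.IsWavefront ρbar f D g₀ c ρbar 0 φ₀)
    (hφ₀_zero : φ₀ 0 = ρbar / 2)
    (ϖ : ℕ → ℝ) (φ : ℕ → ℝ → ℝ)
    (hφ : ∀ n, SemiWave.IsMaximalSemiWavefrontFrom ρbar f D (g n) c ρbar (ϖ n) (φ n))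
    (hϖ : ∀ n, 0 < ϖ n) (hφ_zero : ∀ n, φ n 0 = ρbar / 2)
    (J : Set ℝ) (hJ : SemiWave.IsMaximalOpenInterval ρbar φ₀ J) :
    SemiWave.TendstoC1Loc (fun n => Iio (ϖ n)) φ φ₀ J := by
  obtain ⟨hD_cont, hD_pos⟩ :=
    SemiWave.continuousOn_and_pos_of_condDhat_or_condDtilde (hD.imp_right And.left)
  have hanti : ∀ ρ ∈ Ioo 0 ρbar, Antitone fun n => g n ρ := fun ρ hρ =>
    antitone_nat_of_succ_le fun n => hg_decreasing n ρ (Ioo_subset_Icc_self hρ)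
  refine (mainTheorem4_general
    ⟨hρbar, hf, hD_cont, hD_pos, hg₀.continuousOn, hg₀.pos⟩
    (fun n => ⟨hρbar, hf, hD_cont, hD_pos, (hg n).continuousOn,
      fun ρ hρ => (hg n).pos ρ (Ioo_subset_Ico_self hρ)⟩)
    (fun n ρ hρ => (hanti ρ hρ).le_of_tendsto (hg_tendsto.tendsto_at (Ioo_subset_Icc_self hρ)) n)
    (fun n ρ hρ => hanti ρ hρ n.zero_le) (hg_tendsto.mono Ioo_subset_Icc_self) hφ₀ (t := 0) ?_ hφ hϖ
    fun n => (hφ_zero n).trans hφ₀_zero.symm).mono hJ.prop.2.2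
  rw [hφ₀_zero]
  exact ⟨half_pos hρbar, half_lt_self hρbar⟩
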